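/- Let $N$ be a free abelian group of rank $d$, $M=\mathrm{Hom}(N,\mathbf Z)$, and let $\Sigma$ be a complete rational simplicial fan in $N_{\mathbf R}$, with one-dimensional cones $\rho_1,\dots,\rho_n$ and primitive integral generators $e_1,\dots,e_n\in N$. Let $S=\mathbf C[z_1,\dots,z_n]$, graded by $Cl(\Sigma)=\mathbf Z^n/\alpha(M)$, where $\alpha(m)=(\langle m,e_1\rangle,\dots,\langle m,e_n\rangle)$ and $\deg z_i$ is the class of the $i$-th basis vector; let $Z(\Sigma)\subset\mathbf A^n=\mathbf C^n$ be the common zero set of the monomials $\prod_{\rho_i\not\subset\sigma}z_i$ $(\sigma\in\Sigma)$, $U(\Sigma)=\mathbf A^n\setminus Z(\Sigma)$, $\mathbf D(\Sigma)=\mathrm{Hom}(Cl(\Sigma),\mathbf C^*)\subset(\mathbf C^*)^n$, and $\mathbf P_\Sigma=U(\Sigma)/\mathbf D(\Sigma)$ the toric variety of $\Sigma$. Let $f\in S$ be $\mathbf D(\Sigma)$-homogeneous, i.e. homogeneous of some degree $\beta\in Cl(\Sigma)$, let $\mathbf V(f)\subset\mathbf A^n$ be its zero set (with its reduced structure), and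 let $X\subset\mathbf P_\Sigma$ be the hypersurface defined by $f$, i.e. the image of $\mathbf V(f)\cap U(\Sigma)$. Call $X$ quasi-smooth if $\mathbf V(f)$ is smooth at each of its points outside $Z(\Sigma)$. A finite subgroup $G\subset GL(d,\mathbf C)$ is small if no element of $G$ has $1$ as an eigenvalue of multiplicity exactly $d-1$; a local model of $\mathbf P_\Sigma$ at $p$ is an isomorphism of analytic germs $(\mathbf C^d/G,0)\cong(\mathbf P_\Sigma,p)$ with $G\subset GL(d,\mathbf C)$ finite and small; $\mathbf P_\Sigma$ is a $V$-manifold if it has a local model at every point; and $X$ is a $V$-submanifold of the $V$-manifold $\mathbf P_\Sigma$ if for every $p\in X$ there is a local model of $\mathbf P_\Sigma$ at $p$ for which the inverse image of $X$ in $\mathbf C^d$ is smooth at $0$. Then: 1. $X$ is quasi-smooth if and only if $X$ is a $V$-submanifold of $\mathbf P_\Sigma$ (in particular $\mathbf P_\Sigma$ is then a $V$-manifold). 2. Suppose moreover that $f$ is squarefree. Let $\sigma\in\Sigma$ be a $d$-dimensional cone and let $t\in\mathbf V(f)$ satisfy $t_j=1$ for every $j$ with $e_j$ not a generator of $\sigma$.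 Then $\mathbf V(f)$ is smooth at $t$ if and only if $\frac{\partial f}{\partial z_i}(t)\neq0$ for some $i$ such that $e_i$ is a generator of $\sigma$. -/

import Mathlib

open scoped Topology TensorProduct

noncomputable section

namespace ToricHyp

/-- The cone in `N_ℝ = ℝ ⊗ N` spanned by a finite set `s` of elements of `N`. -/
def cone {N : Type*} [AddCommGroup N] (s : Finset N) : Set (ℝ ⊗[ℤ] N) :=
  {x | ∃ μ : N → ℝ, (∀ e ∈ s, 0 ≤ μ e) ∧ x = ∑ e ∈ s, μ e • ((1 : ℝ) ⊗ₜ[ℤ] e)}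

/-- `s` is the set of integral generators of a rational simplicial cone: its elements are
linearly independent, and a nonnegative rational multiple `(a / b) • e` of one of them lies in
`N` (that is, `b • v = a • e` for some `v : N`) only if `a / b` is an integer. -/
def IsIntegralGenerators {N : Type*} [AddCommGroup N] (s : Finset N) : Prop :=
  LinearIndepOn ℤ id (s : Set N) ∧
    ∀ e ∈ s, ∀ a b : ℕ, 0 < b → (∃ v : N, b • v = a • e) → b ∣ a

/-- A complete rational simplicial fan in `N_ℝ`. A rational simplicial cone is recorded by its
finite set of integral generators, which determines it and is determined by it; the faces of
the cone are the cones spanned by the subsets. -/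
structure Fan (N : Type*) [AddCommGroup N] where
  cones : Set (Finset N)
  finite_cones : cones.Finite
  generators : ∀ s ∈ cones, IsIntegralGenerators s
  face_mem : ∀ s ∈ cones, ∀ t ⊆ s, t ∈ cones
  inter_face : ∀ s ∈ cones, ∀ t ∈ cones, ∃ u, u ⊆ s ∧ u ⊆ t ∧ cone s ∩ cone t = cone u
  complete : (⋃ s ∈ cones, cone s) = Set.univ

section Toric

variable {N : Type*} [AddCommGroup N] (F : Fan N)

/-- The index set of the one-dimensional cones `ρ₁, …, ρₙ`; a ray is given by its integral
generator. -/
def Ray : Type _ := {e : N // {e} ∈ F.cones}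

/-- The integral generator of a ray. -/
def Ray.gen {F : Fan N} (i : Ray F) : N := i.1

instance : Finite (Ray F) :=
  have : Finite F.cones := F.finite_cones
  Finite.of_injective (fun i : Ray F => (⟨{i.1}, i.2⟩ : F.cones))
    (fun i j h => Subtype.ext (by simpa using h))

instance : Fintype (Ray F) := Fintype.ofFinite _

open Classical in
/-- The monomial `∏_{ρᵢ ⊄ σ} zᵢ`; the rays contained in `σ` are those spanned by its
integral generators. -/
def zHat (s : Finset N) : MvPolynomial (Ray F) ℂ :=
  ∏ i with i.gen ∉ s, MvPolynomial.X i

/-- The ideal `B(Σ)`. -/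
def irrelevantIdeal : Ideal (MvPolynomial (Ray F) ℂ) :=
  Ideal.span (zHat F '' F.cones)

/-- The zero set `Z(Σ)` of `B(Σ)` in the affine space `𝔸ⁿ`. -/
def exceptionalSet : Set (Ray F → ℂ) :=
  {z | ∀ b ∈ irrelevantIdeal F, MvPolynomial.eval z b = 0}

/-- `U(Σ) = 𝔸ⁿ \ Z(Σ)`. -/
def stableSet : Set (Ray F → ℂ) := (exceptionalSet F)ᶜ

/-- `α : M → ℤⁿ`, `m ↦ (⟨m, e₁⟩, …, ⟨m, eₙ⟩)`. -/
def alpha : Module.Dual ℤ N →ₗ[ℤ] (Ray F → ℤ) :=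
  LinearMap.pi fun i => LinearMap.applyₗ i.gen

/-- The class group `Cl(Σ) = ℤⁿ / α(M)`. -/
abbrev ClassGp : Type _ := (Ray F → ℤ) ⧸ LinearMap.range (alpha F)

open Classical in
/-- The degree of the variable `zᵢ` in `Cl(Σ)`. -/
def varDegree (i : Ray F) : ClassGp F :=
  Submodule.Quotient.mk (Pi.single i 1)

/-- `f` is `𝐃`-homogeneous of degree `β`: all its monomials have degree `β` in `Cl(Σ)`. -/
def IsDHomogeneous (f : MvPolynomial (Ray F) ℂ) (β : ClassGp F) : Prop :=
  MvPolynomial.IsWeightedHomogeneous (varDegree F) f β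

/-- The group `𝐃(Σ) = Spec ℂ[Cl(Σ)]` as a subgroup of `(ℂ*)ⁿ`: those points whose associated
character of `ℤⁿ` is trivial on `α(M)`. -/
def groupD : Subgroup (Ray F → ℂˣ) where
  carrier := {c | ∀ m : Module.Dual ℤ N, ∏ i, c i ^ alpha F m i = 1}
  one_mem' := by intro m; simp
  mul_mem' := by
    intro a b ha hb m
    simp only [Pi.mul_apply, mul_zpow, Finset.prod_mul_distrib]
    rw [ha m, hb m, one_mul]
  inv_mem' := by
    intro a ha m
    simp only [Pi.inv_apply, inv_zpow, Finset.prod_inv_distrib]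
    rw [ha m, inv_one]

/-- The orbit relation of `𝐃(Σ)` on `U(Σ)`. -/
def orbitSetoid : Setoid (stableSet F) where
  r z w := ∃ c ∈ groupD F, ∀ i, w.1 i = (c i : ℂ) * z.1 i
  iseqv :=
    { refl := fun z => ⟨1, one_mem _, fun i => by simp⟩
      symm := by
        rintro z w ⟨c, hc, h⟩
        exact ⟨c⁻¹, inv_mem hc, fun i => by simp [h i]⟩
      trans := by
        rintro z w v ⟨c, hc, h⟩ ⟨c', hc', h'⟩
        exact ⟨c' * c, mul_mem hc' hc, fun i => by simp [h i, h' i, mul_assoc]⟩ }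

/-- The toric variety `𝐏 = U(Σ)/𝐃(Σ)` (its complex points, with the quotient of the Euclidean
topology). -/
def ToricVariety : Type _ := Quotient (orbitSetoid F)

instance : TopologicalSpace (ToricVariety F) :=
  inferInstanceAs (TopologicalSpace (Quotient (orbitSetoid F)))

/-- The quotient map `U(Σ) → 𝐏`. -/
def toricMk (z : stableSet F) : ToricVariety F := Quotient.mk (orbitSetoid F) z

/-- The zero set `𝐕(f) ⊆ 𝔸ⁿ`. -/
def zeroSet (f : MvPolynomial (Ray F) ℂ) : Set (Ray F → ℂ) :=
  {z | MvPolynomial.eval z f = 0}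

/-- The hypersurface `X ⊆ 𝐏` defined by `f`: the image of `𝐕(f) ∩ U(Σ)`. -/
def hypersurface (f : MvPolynomial (Ray F) ℂ) : Set (ToricVariety F) :=
  toricMk F '' {z | z.1 ∈ zeroSet F f}

end Toric

/-- The orbit relation of a linear group `G` on `ℂᵈ`. -/
def linearSetoid {d : ℕ} (G : Subgroup (Matrix.GeneralLinearGroup (Fin d) ℂ)) :
    Setoid (Fin d → ℂ) where
  r v w := ∃ g ∈ G, w = Matrix.mulVec (g : Matrix (Fin d) (Fin d) ℂ) v
  iseqv :=
    { refl := fun v => ⟨1, one_mem _, by simp⟩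
      symm := by
        rintro v w ⟨g, hg, rfl⟩
        exact ⟨g⁻¹, inv_mem hg, by
          rw [Matrix.mulVec_mulVec, ← Units.val_mul, inv_mul_cancel]; simp⟩
      trans := by
        rintro v w u ⟨g, hg, rfl⟩ ⟨g', hg', rfl⟩
        exact ⟨g' * g, mul_mem hg' hg, by simp [Matrix.mulVec_mulVec]⟩ }

/-- The quotient `ℂᵈ/G`, with the quotient topology. -/
def LinearQuotient {d : ℕ} (G : Subgroup (Matrix.GeneralLinearGroup (Fin d) ℂ)) : Type :=
  Quotient (linearSetoid G)

instance {d : ℕ} (G : Subgroup (Matrix.GeneralLinearGroup (Fin d) ℂ)) :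
    TopologicalSpace (LinearQuotient G) :=
  inferInstanceAs (TopologicalSpace (Quotient (linearSetoid G)))

/-- The quotient map `ℂᵈ → ℂᵈ/G`. -/
def linearMk {d : ℕ} (G : Subgroup (Matrix.GeneralLinearGroup (Fin d) ℂ)) (v : Fin d → ℂ) :
    LinearQuotient G := Quotient.mk (linearSetoid G) v

/-- The structure sheaf of `ℂᵈ/G`: `h` is holomorphic near `x` if its pullback to `ℂᵈ` is
holomorphic near the points over `x`. -/
def LinearQuotient.HolAt {d : ℕ} (G : Subgroup (Matrix.GeneralLinearGroup (Fin d) ℂ))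
    (h : LinearQuotient G → ℂ) (x : LinearQuotient G) : Prop :=
  ∀ v : Fin d → ℂ, linearMk G v = x → AnalyticAt ℂ (fun w => h (linearMk G w)) v

/-- The (analytic) structure sheaf of `𝐏 = U(Σ)/𝐃(Σ)`: `h` is holomorphic near `x` if its
pullback to the open set `U(Σ)` is holomorphic near the points over `x`. -/
def ToricVariety.HolAt {N : Type*} [AddCommGroup N] (F : Fan N)
    (h : ToricVariety F → ℂ) (x : ToricVariety F) : Prop :=
  ∀ z : stableSet F, toricMk F z = x →
    ∃ H : (Ray F → ℂ) → ℂ, AnalyticAt ℂ H z ∧ ∀ᶠ w in 𝓝 z, H w.1 = h (toricMk F w)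

/-- A finite small subgroup of `GL(d, ℂ)`: no element has `1` as an eigenvalue of multiplicity
`d - 1` (elements of a finite group are diagonalizable, so that the multiplicity is the
dimension of the eigenspace). -/
def IsFiniteSmall {d : ℕ} (G : Subgroup (Matrix.GeneralLinearGroup (Fin d) ℂ)) : Prop :=
  Finite G ∧ ∀ g ∈ G, Module.finrank ℂ
    (Module.End.eigenspace (Matrix.toLin' (g : Matrix (Fin d) (Fin d) ℂ)) 1) + 1 ≠ d

/-- `φ` is an analytic isomorphism of germs `(ℂᵈ/G, 0) ≅ (𝐏, p)`: a homeomorphism from an open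
neighbourhood of the origin to an open neighbourhood of `p` that identifies the
holomorphic functions. -/
def IsGermIso {N : Type*} [AddCommGroup N] (F : Fan N) {d : ℕ}
    (G : Subgroup (Matrix.GeneralLinearGroup (Fin d) ℂ)) (p : ToricVariety F)
    (φ : OpenPartialHomeomorph (LinearQuotient G) (ToricVariety F)) : Prop :=
  linearMk G 0 ∈ φ.source ∧ φ (linearMk G 0) = p ∧
    ∀ x ∈ φ.source, ∀ h : ToricVariety F → ℂ,
      ToricVariety.HolAt F h (φ x) ↔ LinearQuotient.HolAt G (fun y => h (φ y)) x

/-- The subset `S` of `ℂᵏ` is smooth (a complex submanifold) at its point `p`: near `p` it is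
the zero set of finitely many holomorphic functions with linearly independent differentials
at `p`. -/
def IsSmoothAt {ι : Type*} [Fintype ι] (S : Set (ι → ℂ)) (p : ι → ℂ) : Prop :=
  ∃ (r : ℕ) (H : (ι → ℂ) → (Fin r → ℂ)), AnalyticAt ℂ H p ∧
    Function.Surjective (fderiv ℂ H p) ∧ ∀ᶠ z in 𝓝 p, z ∈ S ↔ H z = 0

/-- `𝐏` is a `V`-manifold of dimension `d`: it has a local model at every point. -/
def IsVManifold {N : Type*} [AddCommGroup N] (F : Fan N) (d : ℕ) : Prop :=
  ∀ p : ToricVariety F, ∃ G : Subgroup (Matrix.GeneralLinearGroup (Fin d) ℂ),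
    IsFiniteSmall G ∧ ∃ φ, IsGermIso F G p φ

/-- `X` is a `V`-submanifold of the `d`-dimensional `V`-manifold `𝐏`: at every point of `X` there
is a local model in which the inverse image of `X` in `ℂᵈ` is smooth at the origin. -/
def IsVSubmanifold {N : Type*} [AddCommGroup N] (F : Fan N) (d : ℕ)
    (X : Set (ToricVariety F)) : Prop :=
  IsVManifold F d ∧ ∀ p ∈ X, ∃ G : Subgroup (Matrix.GeneralLinearGroup (Fin d) ℂ),
    IsFiniteSmall G ∧ ∃ φ, IsGermIso F G p φ ∧
      IsSmoothAt {v | linearMk G v ∈ φ.source ∧ φ (linearMk G v) ∈ X} 0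

/-- The hypersurface defined by `f` is quasi-smooth: `𝐕(f)` is smooth outside `Z(Σ)`. -/
def IsQuasiSmooth {N : Type*} [AddCommGroup N] (F : Fan N)
    (f : MvPolynomial (Ray F) ℂ) : Prop :=
  ∀ z ∈ zeroSet F f, z ∉ exceptionalSet F → IsSmoothAt (zeroSet F f) z

end ToricHyp

end

/-!
A full-dimensional cone `σ` cuts out the slice `{z | z i = 1 for e i ∉ σ} ≅ ℂᵈ`, which is
transversal to the `𝐃(Σ)`-orbits. The quotient of a neighbourhood of a point of the slice by its
finite stabilizer, which acts diagonally and is small because the generators are primitive, is a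
local model of the toric variety. As `f` is homogeneous, the orbit directions are tangent to
`𝐕(f)`, so `𝐕(f)` is smooth at a point of the slice if and only if its intersection with the slice
is; hence quasi-smooth hypersurfaces are `V`-submanifolds.

Conversely, any local model has to be compared with the slice, i.e. an isomorphism of germs
`ℂᵈ/G ≅ ℂᵈ/G'` with `G` and `G'` small and `G'` diagonal has to be lifted to a biholomorphism.
The `k`-th powers of the coordinates of the target, `k` an exponent of `G'`, pull back to
holomorphic functions that are locally `k`-th powers off the fixed loci of `G`, which have
codimension at least two, and therefore are `k`-th powers of holomorphic functions: extract the
root on the boundary of a small disc, and take its mean. The Jacobian determinant of the lift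
vanishes at most in codimension two, hence nowhere.

For the second part, a smooth `𝐕(f)` meets the lines near `t` in some coordinate direction `i` at
most once. Since `f` is squarefree, its zeros on a generic such line are simple, and by the minimum
principle this persists in the limit: `∂f/∂zᵢ (t) ≠ 0`. Tangency of the orbits finally moves `i`
into `σ`.
-/

noncomputable section

namespace ToricHyp

section OneVariable

open Metric

lemma differentiableAt_of_pow {f : ℂ → ℂ} {z : ℂ} {k : ℕ} (hk : k ≠ 0) (hf : ContinuousAt f z)
    (h0 : f z ≠ 0) (hfk : DifferentiableAt ℂ (fun w => f w ^ k) z) : DifferentiableAt ℂ f z := by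
  have hd : (k : ℂ) * f z ^ (k - 1) ≠ 0 := mul_ne_zero (mod_cast hk) (pow_ne_zero _ h0)
  have hpow := hasStrictDerivAt_pow k (f z)
  have hroot := (hpow.to_localInverse hd).hasDerivAt.differentiableAt
  have hleft : ∀ᶠ w in 𝓝 z, hpow.localInverse _ _ _ hd (f w ^ k) = f w :=
    hf.eventually (hpow.hasStrictFDerivAt_equiv hd).eventually_left_inverse
  exact (hroot.comp z hfk).congr_of_eventuallyEq (hleft.mono fun _ h => h.symm)

lemma exists_differentiableOn_pow_eq_of_ne_zero {g : ℂ → ℂ} {c : ℂ} {r : ℝ} {k : ℕ} (hr : 0 < r)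
    (hk : k ≠ 0) (hg : DifferentiableOn ℂ g (ball c r)) (h0 : ∀ z ∈ ball c r, g z ≠ 0) :
    ∃ f : ℂ → ℂ, DifferentiableOn ℂ f (ball c r) ∧ ∀ z, f z ^ k = g z := by
  have hsc : IsSimplyConnected (ball c r) := by
    have := (convex_ball c r).contractibleSpace ⟨c, mem_ball_self hr⟩
    exact inferInstanceAs (SimplyConnectedSpace (ball c r))
  obtain ⟨f, hfc, hfk⟩ := Complex.exists_continuousOn_pow_eq hsc isOpen_ball hg.continuousOn
    (fun ⟨z, hz, hgz⟩ => h0 z hz hgz) hk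
  refine ⟨f, fun z hz => ?_, hfk⟩
  have hfz : f z ≠ 0 := fun h => h0 z hz (by rw [← hfk, h, zero_pow hk])
  refine (differentiableAt_of_pow hk (hfc.continuousAt (isOpen_ball.mem_nhds hz)) hfz
    ?_).differentiableWithinAt
  simpa only [hfk] using hg.differentiableAt (isOpen_ball.mem_nhds hz)

lemma dvd_divisor {q : ℂ → ℂ} {U : Set ℂ} {k : ℕ} (hq : MeromorphicOn q U)
    (hloc : ∀ z ∈ U, ∃ β : ℂ → ℂ, AnalyticAt ℂ β z ∧ q =ᶠ[𝓝 z] β ^ k) (z : ℂ) :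
    (k : ℤ) ∣ MeromorphicOn.divisor q U z := by
  by_cases hz : z ∈ U
  · obtain ⟨β, hβ, hqβ⟩ := hloc z hz
    rw [MeromorphicOn.divisor_apply hq hz,
      meromorphicOrderAt_congr (hqβ.filter_mono nhdsWithin_le_nhds),
      meromorphicOrderAt_pow hβ.meromorphicAt, WithTop.untop₀_mul, WithTop.untop₀_natCast]
    exact Dvd.intro _ rfl
  · simp [hz]

lemma finprod_sub_zpow_mul {e : ℂ → ℤ} (he : e.support.Finite) (k : ℕ) :
    ∏ᶠ u, (fun x : ℂ => x - u) ^ (e u * k) = (∏ᶠ u, (fun x : ℂ => x - u) ^ e u) ^ k := by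
  rw [finprod_pow (by rwa [Function.HasFiniteMulSupport,
    Function.FactorizedRational.mulSupport])]
  simp only [zpow_mul, zpow_natCast]

lemma exists_differentiableOn_pow_eq_of_locally {q : ℂ → ℂ} {c : ℂ} {r : ℝ} {k : ℕ}
    (hr : 0 < r) (hk : k ≠ 0) (hq : AnalyticOnNhd ℂ q (closedBall c r))
    (hne : ∃ z ∈ closedBall c r, q z ≠ 0)
    (hloc : ∀ z ∈ closedBall c r, ∃ β : ℂ → ℂ, AnalyticAt ℂ β z ∧ q =ᶠ[𝓝 z] β ^ k) :
    ∃ f : ℂ → ℂ, DifferentiableOn ℂ f (ball c r) ∧ ∀ z ∈ ball c r, f z ^ k = q z := by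
  have hm : MeromorphicOn q (closedBall c r) := hq.meromorphicOn
  have htop : ∀ z ∈ closedBall c r, meromorphicOrderAt q z ≠ ⊤ := by
    obtain ⟨z₀, hz₀, hqz₀⟩ := hne
    intro z hz
    refine hm.meromorphicOrderAt_ne_top_of_isPreconnected
      (convex_closedBall c r).isPreconnected hz₀ hz ?_
    rw [(hq z₀ hz₀).meromorphicOrderAt_eq, (hq z₀ hz₀).analyticOrderAt_eq_zero.2 hqz₀]
    simp
  set D := MeromorphicOn.divisor q (closedBall c r) with hD
  have hfin : D.support.Finite := D.finiteSupport (isCompact_closedBall c r)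
  obtain ⟨g, hga, hg0, hqg⟩ := hm.extract_zeros_poles (fun u => htop u u.2) hfin
  let e : ℂ → ℤ := fun z => D z / k
  have hDe : ∀ z, D z = e z * k := fun z => (Int.ediv_mul_cancel (dvd_divisor hm hloc z)).symm
  have he : e.support.Finite := hfin.subset fun z hz h => hz (by simp [e, h])
  have he0 : ∀ z, 0 ≤ e z := fun z =>
    Int.ediv_nonneg (MeromorphicOn.AnalyticOnNhd.divisor_nonneg hq z) k.cast_nonneg
  set Q : ℂ → ℂ := ∏ᶠ u, (fun x : ℂ => x - u) ^ e u
  have hQ : ∀ z, AnalyticAt ℂ Q z := fun z => Function.FactorizedRational.analyticAt (he0 z)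
  simp only [← hD, hDe, finprod_sub_zpow_mul he k] at hqg
  obtain ⟨f, hfd, hfk⟩ := exists_differentiableOn_pow_eq_of_ne_zero hr hk
    (hga.mono ball_subset_closedBall).differentiableOn
    (fun z hz => hg0 ⟨z, ball_subset_closedBall hz⟩)
  refine ⟨Q * f, fun z hz => (hQ z).differentiableAt.differentiableWithinAt.mul (hfd z hz),
    fun z hz => ?_⟩
  have hzU := ball_subset_closedBall hz
  have hpunctured : ∀ᶠ w in 𝓝[≠] z, q w = (Q ^ k • g) w := by
    filter_upwards [mem_codiscreteWithin_iff_forall_mem_nhdsNE.1 hqg z hzU,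
      nhdsWithin_le_nhds (closedBall_mem_nhds_of_mem hz)] with w hw hwU
    exact hw.resolve_right (· hwU)
  have hz := ((hq z hzU).frequently_eq_iff_eventually_eq (((hQ z).pow k).smul (hga z hzU))).1
    hpunctured.frequently
  rw [Pi.mul_apply, mul_pow, hfk, hz.self_of_nhds]
  rfl

lemma le_norm_of_forall_sphere {q : ℂ → ℂ} {c : ℂ} {r m : ℝ} (hr : 0 < r) (hm : 0 < m)
    (hq : DifferentiableOn ℂ q (closedBall c r)) (h0 : ∀ z ∈ closedBall c r, q z ≠ 0)
    (hs : ∀ z ∈ sphere c r, m ≤ ‖q z‖) : ∀ z ∈ closedBall c r, m ≤ ‖q z‖ := by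
  intro z hz
  have hd : DiffContOnCl ℂ (fun z => (q z)⁻¹) (ball c r) := by
    apply DifferentiableOn.diffContOnCl
    rw [closure_ball c hr.ne']
    exact hq.inv h0
  have hmax : ‖(q z)⁻¹‖ ≤ m⁻¹ := by
    refine Complex.norm_le_of_forall_mem_frontier_norm_le isBounded_ball hd (fun w hw => ?_)
      (by rwa [closure_ball c hr.ne'])
    rw [frontier_ball c hr.ne'] at hw
    rw [norm_inv]
    exact inv_anti₀ hm (hs w hw)
  rwa [norm_inv, inv_le_inv₀ (norm_pos_iff.2 (h0 z hz)) hm] at hmax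

end OneVariable

section PointwiseAnalytic

open Metric

variable {𝕜 E F : Type*} [NontriviallyNormedField 𝕜] [NormedAddCommGroup E] [NormedSpace 𝕜 E]
  [NormedAddCommGroup F] [NormedSpace 𝕜 F]

/-- The pointwise extension of a continuous multilinear map to continuous functions on a compact
space. The circle means below use it to see that `f (y + s • u)`, as a function of `s` on a circle,
depends analytically on `y`. -/
def pointwiseMultilinear (K : Type*) [TopologicalSpace K] [CompactSpace K] {n : ℕ}
    (p : ContinuousMultilinearMap 𝕜 (fun _ : Fin n => E) F) :
    ContinuousMultilinearMap 𝕜 (fun _ : Fin n => C(K, E)) C(K, F) :=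
  MultilinearMap.mkContinuous
    { toFun := fun Φ => ⟨fun s => p fun i => Φ i s, by fun_prop⟩
      map_update_add' := fun Φ i x y => by
        have heval := fun (s : K) z =>
          funext (Function.apply_update (fun _ (φ : C(K, E)) => φ s) Φ i z)
        ext s
        simp [heval]
      map_update_smul' := fun Φ i c x => by
        have heval := fun (s : K) z =>
          funext (Function.apply_update (fun _ (φ : C(K, E)) => φ s) Φ i z)
        ext s
        simp [heval] }
    ‖p‖ fun Φ => by
      refine (ContinuousMap.norm_le _ (by positivity)).2 fun s => (p.le_opNorm _).trans ?_
      gcongr with i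
      exact (Φ i).norm_coe_le_norm s

lemma exists_analyticOnNhd_postcomp [CompleteSpace F] {f : E → F} {p : E}
    (hf : AnalyticAt 𝕜 f p) :
    ∃ ρ > 0, ∀ (K : Type*) [TopologicalSpace K] [CompactSpace K], ∃ A : C(K, E) → C(K, F),
      AnalyticOnNhd 𝕜 A (ball 0 ρ) ∧ ∀ Φ ∈ ball 0 ρ, ∀ s, A Φ s = f (p + Φ s) := by
  obtain ⟨q, R, hq⟩ := hf
  obtain ⟨ρ, hρ, hρR⟩ : ∃ ρ : NNReal, 0 < ρ ∧ (ρ : ENNReal) < R :=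
    let ⟨ρ, h0, hR⟩ := ENNReal.lt_iff_exists_nnreal_btwn.1 hq.r_pos
    ⟨ρ, ENNReal.coe_pos.1 h0, hR⟩
  refine ⟨ρ, NNReal.coe_pos.2 hρ, fun K _ _ => ?_⟩
  let P : FormalMultilinearSeries 𝕜 C(K, E) C(K, F) := fun n => pointwiseMultilinear K (q n)
  have hqP : R ≤ P.radius := hq.r_le.trans <| FormalMultilinearSeries.radius_le_of_le fun n =>
    MultilinearMap.mkContinuous_norm_le _ (norm_nonneg _) _
  have hP := (P.hasFPowerSeriesOnBall (hq.r_pos.trans_le hqP)).mono hq.r_pos hqP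
  have hball : ∀ Φ ∈ ball (0 : C(K, E)) ρ, Φ ∈ eball (0 : C(K, E)) R := fun Φ hΦ =>
    eball_subset_eball hρR.le (by rwa [eball_coe])
  refine ⟨P.sum, fun Φ hΦ => hP.analyticAt_of_mem (hball Φ hΦ), fun Φ hΦ s => ?_⟩
  have hs : Φ s ∈ eball (0 : E) R := by
    refine eball_subset_eball hρR.le ?_
    rw [eball_coe, mem_ball_zero_iff]
    exact (Φ.norm_coe_le_norm s).trans_lt (mem_ball_zero_iff.1 hΦ)
  exact ((P.hasSum (eball_subset_eball hqP (hball Φ hΦ))).mapL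
    (ContinuousMap.evalCLM 𝕜 s)).unique (hq.hasSum hs)

lemma exists_analyticAt_translate [CompleteSpace F] {f : E → F} {p : E}
    (hf : AnalyticAt 𝕜 f p) :
    ∃ ρ > 0, ∀ (K : Type*) [TopologicalSpace K] [CompactSpace K] (v : C(K, E)), ‖v‖ < ρ →
      ∃ V : E → C(K, F), AnalyticAt 𝕜 V p ∧ ∀ᶠ y in 𝓝 p, ∀ s, V y s = f (y + v s) := by
  obtain ⟨ρ, hρ, hpost⟩ := exists_analyticOnNhd_postcomp hf
  refine ⟨ρ, hρ, fun K _ _ v hv => ?_⟩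
  obtain ⟨A, hA, hAf⟩ := hpost K
  let e : E → C(K, E) := fun y => ContinuousLinearMap.const 𝕜 K (y - p) + v
  have he : AnalyticAt 𝕜 e p := ((ContinuousLinearMap.const 𝕜 K (M := E)).analyticAt _).comp_of_eq
    (analyticAt_id.sub analyticAt_const) rfl |>.add analyticAt_const
  have hep : e p ∈ ball 0 ρ := by simpa [e] using hv
  refine ⟨A ∘ e, (hA _ hep).comp he, ?_⟩
  filter_upwards [he.continuousAt (isOpen_ball.mem_nhds hep)] with y hy s
  rw [Function.comp_apply, hAf _ hy]
  congr 1
  change p + (y - p + v s) = _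
  abel

end PointwiseAnalytic

section Roots

variable {𝕜 : Type*} [RCLike 𝕜]

lemma exists_analyticAt_localInverse {E F : Type*} [NormedAddCommGroup E] [NormedSpace 𝕜 E]
    [CompleteSpace E] [NormedAddCommGroup F] [NormedSpace 𝕜 F] [CompleteSpace F] {f : E → F} {x : E}
    (hf : AnalyticAt 𝕜 f x) (i : E ≃L[𝕜] F) (hi : fderiv 𝕜 f x = i) :
    ∃ e : OpenPartialHomeomorph E F, x ∈ e.source ∧ ⇑e = f ∧ AnalyticAt 𝕜 e.symm (f x) := by
  have hs : HasStrictFDerivAt f (i : E →L[𝕜] F) x := hi ▸ hf.hasStrictFDerivAt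
  have hx := hs.mem_toOpenPartialHomeomorph_source
  have he := hs.toOpenPartialHomeomorph_coe
  refine ⟨hs.toOpenPartialHomeomorph f, hx, he, ?_⟩
  have h := (hs.toOpenPartialHomeomorph f).analyticAt_symm' (i := i) hx
  rw [he] at h
  exact h hf hi

variable {A : Type*} [NormedCommRing A] [NormedAlgebra 𝕜 A] [CompleteSpace A]

variable (A) in
lemma exists_analyticAt_root {k : ℕ} (hk : k ≠ 0) :
    ∃ g : A → A, AnalyticAt 𝕜 g 1 ∧ ∀ᶠ a in 𝓝 1, g a ^ k = a := by
  have hf : AnalyticAt 𝕜 (fun a : A => a ^ k) 1 := analyticAt_id.pow k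
  let i : A ≃L[𝕜] A := ContinuousLinearEquiv.smulLeft (Units.mk0 (k : 𝕜) (mod_cast hk))
  have hi : fderiv 𝕜 (fun a : A => a ^ k) 1 = i := by
    ext a
    rw [(hasFDerivAt_pow k).fderiv]
    simp [i, Units.smul_def, Algebra.smul_def]
  obtain ⟨e, he1, he, hsymm⟩ := exists_analyticAt_localInverse hf i hi
  have h1 : e 1 = 1 := by simp [he]
  simp only [one_pow] at hsymm
  refine ⟨e.symm, hsymm, ?_⟩
  filter_upwards [e.open_target.mem_nhds (h1 ▸ e.map_source he1)] with a ha
  simpa [he] using e.right_inv ha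

lemma exists_analyticAt_pow_eq_of_frequently {E : Type*} [NormedAddCommGroup E] [NormedSpace 𝕜 E]
    {V : E → A} {p : E} {k : ℕ} (hk : k ≠ 0) (hV : AnalyticAt 𝕜 V p) (hu : IsUnit (V p))
    (hfr : ∃ᶠ y in 𝓝 p, ∃ a, a ^ k = V y) :
    ∃ Q : E → A, AnalyticAt 𝕜 Q p ∧ ∀ᶠ y in 𝓝 p, Q y ^ k = V y := by
  obtain ⟨v, hv⟩ := hu
  obtain ⟨g, hg, hgk⟩ := exists_analyticAt_root (𝕜 := 𝕜) A hk
  let W : E → A := fun y => V y * ↑v⁻¹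
  have hW : AnalyticAt 𝕜 W p := hV.mul analyticAt_const
  have hWp : W p = 1 := by simp [W, ← hv]
  have hT : AnalyticAt 𝕜 (g ∘ W) p := hg.comp_of_eq hW hWp
  have hTk : ∀ᶠ y in 𝓝 p, g (W y) ^ k * v = V y := by
    filter_upwards [hW.continuousAt.eventually (hWp ▸ hgk)] with y hy
    simp [hy, W]
  have hunit : ∀ᶠ y in 𝓝 p, IsUnit (V y) :=
    hV.continuousAt (Units.isOpen.mem_nhds (hv ▸ v.isUnit))
  obtain ⟨y₀, ⟨a, ha⟩, hy₀, hy₀u⟩ := (hfr.and_eventually (hTk.and hunit)).exists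
  have hTu : IsUnit (g (W y₀)) := (isUnit_pow_iff hk).1 (isUnit_of_mul_isUnit_left (hy₀ ▸ hy₀u))
  have hv' : (a * ↑hTu.unit⁻¹) ^ k = v := by
    rw [mul_pow, ha, ← hy₀, mul_right_comm, ← mul_pow, hTu.mul_val_inv, one_pow, one_mul]
  refine ⟨fun y => a * ↑hTu.unit⁻¹ * g (W y), analyticAt_const.mul hT, ?_⟩
  filter_upwards [hTk] with y hy
  rw [mul_pow, hv', mul_comm, hy]

end Roots

section Circle

open Metric

lemma exists_diffContOnCl_pow_eq {q : ℂ → ℂ} {c : ℂ} {r R : ℝ} {k : ℕ} (hr : 0 < r) (hrR : r < R)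
    (hk : k ≠ 0) (hq : AnalyticOnNhd ℂ q (closedBall c R)) (hne : ∃ z ∈ closedBall c R, q z ≠ 0)
    (hloc : ∀ z ∈ closedBall c R, ∃ β : ℂ → ℂ, AnalyticAt ℂ β z ∧ q =ᶠ[𝓝 z] β ^ k) :
    ∃ f : ℂ → ℂ, DiffContOnCl ℂ f (ball c r) ∧ ∀ z ∈ closedBall c r, f z ^ k = q z := by
  obtain ⟨f, hf, hfk⟩ := exists_differentiableOn_pow_eq_of_locally (hr.trans hrR) hk hq hne hloc
  have hsub : closedBall c r ⊆ ball c R := closedBall_subset_ball hrR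
  refine ⟨f, DifferentiableOn.diffContOnCl ?_, fun z hz => hfk z (hsub hz)⟩
  rw [closure_ball _ hr.ne']
  exact hf.mono hsub

lemma exists_eq_smul_of_pow_eq {K : Type*} [TopologicalSpace K] [PreconnectedSpace K] [Nonempty K]
    {a b : C(K, ℂ)} {k : ℕ} (hk : k ≠ 0) (hab : ∀ s, a s ^ k = b s ^ k) (hb : ∀ s, b s ≠ 0) :
    ∃ ζ : ℂ, ζ ^ k = 1 ∧ a = ζ • b := by
  let w : K → ℂ := fun s => a s / b s
  have hw : Continuous w := a.continuous.div₀ b.continuous hb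
  have hwk : ∀ s, w s ^ k = 1 := fun s => by
    rw [div_pow, hab, div_self (pow_ne_zero _ (hb s))]
  have hfin : (Set.range w).Finite := by
    refine (Polynomial.nthRootsFinset k (1 : ℂ)).finite_toSet.subset ?_
    rintro _ ⟨s, rfl⟩
    exact (Polynomial.mem_nthRootsFinset (Nat.pos_of_ne_zero hk) _).2 (hwk s)
  obtain ⟨s₀⟩ := ‹Nonempty K›
  refine ⟨w s₀, hwk s₀, ContinuousMap.ext fun s => ?_⟩
  have hconst : w s = w s₀ := hfin.countable.isTotallyDisconnected _ subset_rfl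
    (isPreconnected_range hw) ⟨s, rfl⟩ ⟨s₀, rfl⟩
  rw [ContinuousMap.smul_apply, smul_eq_mul, ← hconst, div_mul_cancel₀ _ (hb s)]

lemma exists_circleMean {r : ℝ} (hr : 0 < r) :
    ∃ Λ : C(sphere (0 : ℂ) r, ℂ) →L[ℂ] ℂ, ∀ (f : ℂ → ℂ) (Φ : C(sphere (0 : ℂ) r, ℂ)),
      DiffContOnCl ℂ f (ball 0 r) → (∀ s, Φ s = f s) → Λ Φ = f 0 := by
  let γ : ℝ → sphere (0 : ℂ) r := fun θ => ⟨circleMap 0 r θ, circleMap_mem_sphere 0 hr.le θ⟩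
  have hγ : Continuous γ := Continuous.subtype_mk (by fun_prop) _
  have hint (Φ : C(sphere (0 : ℂ) r, ℂ)) :
      IntervalIntegrable (fun θ => Φ (γ θ)) MeasureTheory.volume 0 (2 * Real.pi) :=
    (Φ.continuous.comp hγ).intervalIntegrable _ _
  let I : C(sphere (0 : ℂ) r, ℂ) →ₗ[ℂ] ℂ :=
    { toFun := fun Φ => ∫ θ in (0)..(2 * Real.pi), Φ (γ θ)
      map_add' := fun Φ Ψ => intervalIntegral.integral_add (hint Φ) (hint Ψ)
      map_smul' := fun c Φ => intervalIntegral.integral_smul c fun θ => Φ (γ θ) }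
  have hI : ∀ Φ, ‖I Φ‖ ≤ |2 * Real.pi - 0| * ‖Φ‖ := fun Φ => by
    rw [mul_comm]
    exact intervalIntegral.norm_integral_le_of_norm_le_const fun θ _ => Φ.norm_coe_le_norm _
  refine ⟨((2 * Real.pi)⁻¹ : ℝ) • I.mkContinuous _ hI, fun f Φ hf hΦ => ?_⟩
  rw [← DiffContOnCl.circleAverage (f := f) (R := r) (c := 0) (by rwa [abs_of_pos hr]),
    Real.circleAverage, smul_apply]
  exact congrArg _ (intervalIntegral.integral_congr fun θ _ => hΦ _)

lemma circleMean_pow_eq {r : ℝ} {k : ℕ} (hr : 0 < r) (hk : k ≠ 0)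
    {Λ : C(sphere (0 : ℂ) r, ℂ) →L[ℂ] ℂ}
    (hΛ : ∀ (f : ℂ → ℂ) (Φ : C(sphere (0 : ℂ) r, ℂ)), DiffContOnCl ℂ f (ball 0 r) →
      (∀ s, Φ s = f s) → Λ Φ = f 0)
    {f : ℂ → ℂ} (hf : DiffContOnCl ℂ f (ball 0 r)) {Q : C(sphere (0 : ℂ) r, ℂ)}
    (hQ : ∀ s, Q s ≠ 0) (hfQ : ∀ s : sphere (0 : ℂ) r, Q s ^ k = f s ^ k) :
    Λ Q ^ k = f 0 ^ k := by
  have : PreconnectedSpace (sphere (0 : ℂ) r) := isPreconnected_iff_preconnectedSpace.1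
    (isPreconnected_sphere (by rw [Complex.rank_real_complex]; norm_num) _ _)
  have : Nonempty (sphere (0 : ℂ) r) := (NormedSpace.sphere_nonempty.2 hr.le).to_subtype
  have hfc : ContinuousOn f (sphere 0 r) := hf.continuousOn.mono <| by
    rw [closure_ball _ hr.ne']
    exact sphere_subset_closedBall
  obtain ⟨ζ, hζ, hfζ⟩ := exists_eq_smul_of_pow_eq (a := ⟨_, hfc.domRestrict⟩) hk
    (fun s => (hfQ s).symm) hQ
  have hmean : ζ * Λ Q = f 0 := by
    rw [← smul_eq_mul, ← map_smul, ← hfζ]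
    exact hΛ f _ hf fun _ => rfl
  rw [← hmean, mul_pow, hζ, one_mul]

end Circle

section Lines

open Metric Filter

variable {E : Type*} [NormedAddCommGroup E] [NormedSpace ℂ E]

lemma analyticAt_comp_line {h : E → ℂ} {y u : E} {s : ℂ} (hh : AnalyticAt ℂ h (y + s • u)) :
    AnalyticAt ℂ (fun t : ℂ => h (y + t • u)) s :=
  hh.comp_of_eq (f := fun t : ℂ => y + t • u) (by fun_prop) rfl

lemma exists_pos_forall_sphere_le_norm {J : E → ℂ} {p u : E} {r : ℝ}
    (hJ : ∀ s ∈ sphere (0 : ℂ) r, ContinuousAt J (p + s • u))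
    (h0 : ∀ s ∈ sphere (0 : ℂ) r, J (p + s • u) ≠ 0) :
    ∃ m > 0, ∀ᶠ y in 𝓝 p, ∀ s ∈ sphere (0 : ℂ) r, m ≤ ‖J (y + s • u)‖ := by
  have hc : ContinuousOn (fun s : ℂ => ‖J (p + s • u)‖) (sphere 0 r) := fun s hs =>
    ((hJ s hs).comp (f := fun s : ℂ => p + s • u) (by fun_prop)).norm.continuousWithinAt
  obtain ⟨m, hm0, hm⟩ : ∃ m > 0, ∀ s ∈ sphere (0 : ℂ) r, m < ‖J (p + s • u)‖ := by
    rcases (sphere (0 : ℂ) r).eq_empty_or_nonempty with he | hne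
    · exact ⟨1, one_pos, by simp [he]⟩
    · obtain ⟨s₀, hs₀, hmin⟩ := (isCompact_sphere (0 : ℂ) r).exists_isMinOn hne hc
      have hpos := norm_pos_iff.2 (h0 s₀ hs₀)
      exact ⟨_, half_pos hpos, fun s hs => (half_lt_self hpos).trans_le (hmin hs)⟩
  refine ⟨m, hm0, (isCompact_sphere (0 : ℂ) r).eventually_forall_of_forall_eventually
    fun s hs => ?_⟩
  have hcont : ContinuousAt (fun q : E × ℂ => ‖J (q.1 + q.2 • u)‖) (p, s) :=
    (ContinuousAt.comp (g := J) (f := fun q : E × ℂ => q.1 + q.2 • u) (x := (p, s)) (hJ s hs)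
      (by fun_prop)).norm
  exact (hcont.eventually_const_lt (hm s hs)).mono fun q hq => hq.le

lemma exists_line_frequently_ne_zero {h : E → ℂ} {p : E} (hh : AnalyticAt ℂ h p)
    (h0 : ∃ᶠ x in 𝓝 p, h x ≠ 0) : ∃ u : E, ∃ᶠ s in 𝓝 (0 : ℂ), h (p + s • u) ≠ 0 := by
  obtain ⟨ε, hε, hball⟩ := Metric.eventually_nhds_iff_ball.1 hh.eventually_analyticAt
  obtain ⟨x, hx0, hx⟩ := (h0.and_eventually (ball_mem_nhds p hε)).exists
  refine ⟨x - p, fun hev => hx0 ?_⟩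
  let ℓ : ℂ →ᵃ[ℝ] E := AffineMap.const ℝ ℂ p +
    ((LinearMap.toSpanSingleton ℂ E (x - p)).restrictScalars ℝ).toAffineMap
  have hℓ : ∀ s, ℓ s = p + s • (x - p) := fun s => rfl
  have han : AnalyticOnNhd ℂ (fun s : ℂ => h (p + s • (x - p))) (ℓ ⁻¹' ball p ε) := fun s hs =>
    analyticAt_comp_line (hball _ (hℓ s ▸ hs))
  have := han.eqOn_zero_of_preconnected_of_eventuallyEq_zero
    ((convex_ball p ε).affine_preimage ℓ).isPreconnected (z₀ := 0)
    (by simp [hℓ, hε]) (hev.mono fun s hs => by simpa using hs)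
    (show (1 : ℂ) ∈ ℓ ⁻¹' ball p ε by simpa [hℓ] using hx)
  simpa using this

lemma exists_disc_ne_zero_of_line {h : E → ℂ} {p u : E} (hh : AnalyticAt ℂ h p)
    (hu : ∃ᶠ s in 𝓝 (0 : ℂ), h (p + s • u) ≠ 0) {W : Set E} (hW : W ∈ 𝓝 p) :
    ∃ r : ℝ, 0 < r ∧ (∀ s : ℂ, ‖s‖ ≤ r → s ≠ 0 → h (p + s • u) ≠ 0) ∧
      ∀ᶠ y in 𝓝 p, ∀ s : ℂ, ‖s‖ ≤ r → y + s • u ∈ W := by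
  have hline : ∀ᶠ s in 𝓝[≠] (0 : ℂ), h (p + s • u) ≠ 0 :=
    (analyticAt_comp_line (by simpa using hh)).eventually_eq_zero_or_eventually_ne_zero.resolve_left
      fun hev => hu (hev.mono fun s hs => not_not.2 hs)
  have hmem : ∀ᶠ q : E × ℂ in 𝓝 p ×ˢ 𝓝 0, q.1 + q.2 • u ∈ W := by
    have hcont : ContinuousAt (fun q : E × ℂ => q.1 + q.2 • u) (p, 0) := by fun_prop
    rw [← nhds_prod_eq]
    exact hcont.preimage_mem_nhds (by simpa using hW)
  obtain ⟨a, ha, b, hb, hab⟩ := eventually_prod_iff.1 hmem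
  obtain ⟨r, hr, hball⟩ := Metric.nhds_basis_closedBall.eventually_iff.1
    (hb.and (eventually_nhdsWithin_iff.1 hline))
  refine ⟨r, hr, fun s hs hs0 => ?_, ha.mono fun y hy s hs => ?_⟩
  · exact (hball (mem_closedBall_zero_iff.2 hs)).2 hs0
  · exact hab hy (hball (mem_closedBall_zero_iff.2 hs)).1

lemma exists_disc_ne_zero {h : E → ℂ} {p : E} (hh : AnalyticAt ℂ h p)
    (h0 : ∃ᶠ x in 𝓝 p, h x ≠ 0) {W : Set E} (hW : W ∈ 𝓝 p) :
    ∃ (u : E) (r : ℝ), 0 < r ∧ (∀ s : ℂ, ‖s‖ ≤ r → s ≠ 0 → h (p + s • u) ≠ 0) ∧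
      ∀ᶠ y in 𝓝 p, ∀ s : ℂ, ‖s‖ ≤ r → y + s • u ∈ W := by
  obtain ⟨u, hu⟩ := exists_line_frequently_ne_zero hh h0
  exact ⟨u, exists_disc_ne_zero_of_line hh hu hW⟩

/-- A set that is avoided by the generic line in each direction: the only property of an analytic
subset of codimension at least two that the Hartogs-type arguments below need. -/
def IsLineThin (S : Set E) : Prop :=
  ∀ u : E, Dense {y | ∀ s : ℂ, y + s • u ∉ S}

namespace IsLineThin

variable {S : Set E}

lemma frequently_forall_notMem (hS : IsLineThin S) (p u : E) :
    ∃ᶠ y in 𝓝 p, ∀ s : ℂ, y + s • u ∉ S :=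
  mem_closure_iff_frequently.1 (hS u p)

lemma frequently_notMem (hS : IsLineThin S) (p : E) : ∃ᶠ y in 𝓝 p, y ∉ S :=
  (hS.frequently_forall_notMem p 0).mono fun y hy => by simpa using hy 0

lemma ne_zero {J : E → ℂ} {p : E} (hS : IsLineThin S) (hJ : AnalyticAt ℂ J p)
    (hJS : ∀ᶠ x in 𝓝 p, x ∉ S → J x ≠ 0) : J p ≠ 0 := by
  obtain ⟨u, r, hr, hr0, hrW⟩ := exists_disc_ne_zero hJ
    ((hS.frequently_notMem p).and_eventually hJS |>.mono fun y hy => hy.2 hy.1)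
    (hJ.eventually_analyticAt.and hJS)
  have hsphere : ∀ s ∈ sphere (0 : ℂ) r, ‖s‖ ≤ r ∧ s ≠ 0 := fun s hs =>
    ⟨(mem_sphere_zero_iff_norm.1 hs).le, ne_of_mem_sphere hs hr.ne'⟩
  obtain ⟨m, hm, hmy⟩ := exists_pos_forall_sphere_le_norm
    (fun s hs => (hrW.self_of_nhds s (hsphere s hs).1).1.continuousAt)
    (fun s hs => hr0 s (hsphere s hs).1 (hsphere s hs).2)
  have hfr : ∃ᶠ y in 𝓝 p, m ≤ ‖J y‖ := by
    refine ((hS.frequently_forall_notMem p u).and_eventually (hrW.and hmy)).mono ?_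
    rintro y ⟨hy, hyW, hym⟩
    have hmin := le_norm_of_forall_sphere (q := fun s => J (y + s • u)) hr hm
      (fun s hs => (analyticAt_comp_line
        (hyW s (mem_closedBall_zero_iff.1 hs)).1).differentiableAt.differentiableWithinAt)
      (fun s hs => (hyW s (mem_closedBall_zero_iff.1 hs)).2 (hy s)) hym 0
      (mem_closedBall_self hr.le)
    simpa using hmin
  exact norm_pos_iff.1 (hm.trans_le (isClosed_Ici.mem_of_frequently_of_tendsto hfr
    hJ.continuousAt.norm))

lemma eventuallyEq {f g : E → ℂ} {p u : E} (hS : IsLineThin S) (hf : AnalyticAt ℂ f p)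
    (hg : AnalyticAt ℂ g p) (hfg : ∀ᶠ y in 𝓝 p, (∀ s : ℂ, y + s • u ∉ S) → f y = g y) :
    f =ᶠ[𝓝 p] g := by
  filter_upwards [hfg.eventually_nhds, hf.eventually_analyticAt, hg.eventually_analyticAt]
    with y hy hfy hgy
  refine sub_eq_zero.1 <| isClosed_singleton.mem_of_frequently_of_tendsto
    (((hS.frequently_forall_notMem y u).and_eventually hy).mono fun x hx => ?_)
    (hfy.continuousAt.sub hgy.continuousAt)
  exact sub_eq_zero.2 (hx.2 hx.1)

lemma exists_diffContOnCl_pow_eq_line {h : E → ℂ} {y u : E} {k : ℕ} {r R : ℝ} (hr : 0 < r)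
    (hrR : r < R) (hk : k ≠ 0)
    (hh : ∀ s : ℂ, ‖s‖ ≤ R → AnalyticAt ℂ h (y + s • u))
    (hloc : ∀ s : ℂ, ‖s‖ ≤ R → ∃ β : E → ℂ, AnalyticAt ℂ β (y + s • u) ∧
      h =ᶠ[𝓝 (y + s • u)] β ^ k)
    (hne : ∃ s : ℂ, ‖s‖ ≤ R ∧ h (y + s • u) ≠ 0) :
    ∃ f : ℂ → ℂ, DiffContOnCl ℂ f (ball 0 r) ∧
      ∀ s ∈ closedBall (0 : ℂ) r, f s ^ k = h (y + s • u) := by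
  simp only [← mem_closedBall_zero_iff (E := ℂ)] at hh hloc hne
  refine exists_diffContOnCl_pow_eq hr hrR hk (fun s hs => analyticAt_comp_line (hh s hs)) hne
    fun s hs => ?_
  obtain ⟨β, hβ, hhβ⟩ := hloc s hs
  have hcont : ContinuousAt (fun s : ℂ => y + s • u) s := by fun_prop
  exact ⟨fun s => β (y + s • u), analyticAt_comp_line hβ, hcont.eventually hhβ⟩

lemma exists_circle_root {h : E → ℂ} {p : E} {k : ℕ} (hS : IsLineThin S) (hk : k ≠ 0)
    (hh : AnalyticAt ℂ h p) (h0 : ∃ᶠ x in 𝓝 p, h x ≠ 0)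
    (hloc : ∀ᶠ x in 𝓝 p, x ∉ S → ∃ β : E → ℂ, AnalyticAt ℂ β x ∧ h =ᶠ[𝓝 x] β ^ k) :
    ∃ (u : E) (r : ℝ) (Q : E → C(sphere (0 : ℂ) r, ℂ)), 0 < r ∧ AnalyticAt ℂ Q p ∧
      ∀ᶠ y in 𝓝 p, (∀ s : sphere (0 : ℂ) r, h (y + (s : ℂ) • u) ≠ 0 ∧
          Q y s ^ k = h (y + (s : ℂ) • u)) ∧
        ((∀ s : ℂ, y + s • u ∉ S) → ∃ f : ℂ → ℂ, DiffContOnCl ℂ f (ball 0 r) ∧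
          ∀ s ∈ closedBall (0 : ℂ) r, f s ^ k = h (y + s • u)) := by
  obtain ⟨ρ, hρ, htrans⟩ := exists_analyticAt_translate hh
  obtain ⟨u, R, hR, hR0, hRW⟩ := exists_disc_ne_zero hh h0
    (inter_mem (ball_mem_nhds p hρ) (hh.eventually_analyticAt.and hloc))
  have hr : 0 < R / 2 := half_pos hR
  have hrR : R / 2 < R := half_lt_self hR
  set r := R / 2
  have hsphere : ∀ s : sphere (0 : ℂ) r, ‖(s : ℂ)‖ ≤ R ∧ (s : ℂ) ≠ 0 := fun s =>
    ⟨(mem_sphere_zero_iff_norm.1 s.2).trans_le hrR.le, ne_of_mem_sphere s.2 hr.ne'⟩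
  obtain ⟨V, hV, hVh⟩ := htrans (sphere (0 : ℂ) r) ⟨fun s => (s : ℂ) • u, by fun_prop⟩ <|
    (ContinuousMap.norm_lt_iff _ hρ).2 fun s => by
      simpa using (hRW.self_of_nhds s (hsphere s).1).1
  have hVp : IsUnit (V p) := ContinuousMap.isUnit_iff_forall_ne_zero _ |>.2 fun s => by
    simpa [hVh.self_of_nhds s] using hR0 s (hsphere s).1 (hsphere s).2
  have hdisc : ∀ᶠ y in 𝓝 p, (∀ s : sphere (0 : ℂ) r, h (y + (s : ℂ) • u) ≠ 0) ∧
      ((∀ s : ℂ, y + s • u ∉ S) → ∃ f : ℂ → ℂ, DiffContOnCl ℂ f (ball 0 r) ∧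
        ∀ s ∈ closedBall (0 : ℂ) r, f s ^ k = h (y + s • u)) := by
    filter_upwards [hRW, hVh, hV.continuousAt (Units.isOpen.mem_nhds hVp)] with y hy hyV hyu
    have hne : ∀ s : sphere (0 : ℂ) r, h (y + (s : ℂ) • u) ≠ 0 := fun s => by
      simpa [hyV s] using (ContinuousMap.isUnit_iff_forall_ne_zero _).1 hyu s
    obtain ⟨s₀, hs₀⟩ : (sphere (0 : ℂ) r).Nonempty := NormedSpace.sphere_nonempty.2 hr.le
    exact ⟨hne, fun hyS => exists_diffContOnCl_pow_eq_line hr hrR hk (fun s hs => (hy s hs).2.1)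
      (fun s hs => (hy s hs).2.2 (hyS s)) ⟨s₀, (hsphere ⟨s₀, hs₀⟩).1, hne ⟨s₀, hs₀⟩⟩⟩
  obtain ⟨Q, hQ, hQV⟩ := exists_analyticAt_pow_eq_of_frequently hk hV hVp <| by
    refine ((hS.frequently_forall_notMem p u).and_eventually (hdisc.and hVh)).mono ?_
    rintro y ⟨hyS, ⟨-, hyf⟩, hyV⟩
    obtain ⟨f, hf, hfk⟩ := hyf hyS
    have hfc : ContinuousOn f (sphere 0 r) := hf.continuousOn_ball.mono sphere_subset_closedBall
    refine ⟨⟨_, hfc.domRestrict⟩, ContinuousMap.ext fun s => ?_⟩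
    exact (hfk s (sphere_subset_closedBall s.2)).trans (hyV s).symm
  refine ⟨u, r, Q, hr, hQ, ?_⟩
  filter_upwards [hdisc, hQV, hVh] with y hy hyQ hyV
  refine ⟨fun s => ⟨hy.1 s, ?_⟩, hy.2⟩
  rw [← ContinuousMap.pow_apply, hyQ, hyV]
  rfl

lemma exists_pow_eq {h : E → ℂ} {p : E} {k : ℕ} (hS : IsLineThin S) (hk : k ≠ 0)
    (hh : AnalyticAt ℂ h p)
    (hloc : ∀ᶠ x in 𝓝 p, x ∉ S → ∃ β : E → ℂ, AnalyticAt ℂ β x ∧ h =ᶠ[𝓝 x] β ^ k) :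
    ∃ g : E → ℂ, AnalyticAt ℂ g p ∧ ∀ᶠ y in 𝓝 p, g y ^ k = h y := by
  by_cases h0 : ∃ᶠ x in 𝓝 p, h x ≠ 0
  · obtain ⟨u, r, Q, hr, hQ, hQh⟩ := hS.exists_circle_root hk hh h0 hloc
    obtain ⟨Λ, hΛ⟩ := exists_circleMean hr
    have hg : AnalyticAt ℂ (fun y => Λ (Q y)) p := (Λ.analyticAt _).comp hQ
    refine ⟨_, hg, hS.eventuallyEq (u := u) (hg.pow k) hh ?_⟩
    filter_upwards [hQh] with y ⟨hyQ, hyf⟩ hyS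
    obtain ⟨f, hf, hfk⟩ := hyf hyS
    rw [circleMean_pow_eq hr hk hΛ hf
      (fun s hs => (hyQ s).1 (by rw [← (hyQ s).2, hs, zero_pow hk]))
      (fun s => (hyQ s).2.trans (hfk s (sphere_subset_closedBall s.2)).symm),
      hfk 0 (mem_closedBall_self hr.le), zero_smul, add_zero]
  · refine ⟨0, analyticAt_const, (not_frequently.1 h0).mono fun x hx => ?_⟩
    rw [not_not.1 hx, Pi.zero_apply, zero_pow hk]

end IsLineThin

lemma isLineThin_iUnion_submodule [FiniteDimensional ℂ E] {ι : Type*} [Finite ι]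
    (V : ι → Submodule ℂ E) (hV : ∀ i, Module.finrank ℂ (V i) + 1 < Module.finrank ℂ E) :
    IsLineThin (⋃ i, (V i : Set E)) := by
  intro u
  have : CompleteSpace E := FiniteDimensional.complete ℂ E
  let W : ι → Submodule ℂ E := fun i => V i ⊔ ℂ ∙ u
  have hW : ∀ i, W i ≠ ⊤ := fun i hi => by
    have hsup := Submodule.finrank_add_le_finrank_add_finrank (V i) (ℂ ∙ u)
    have hspan : Module.finrank ℂ (ℂ ∙ u) ≤ 1 := by
      simpa using finrank_span_le_card (R := ℂ) ({u} : Set E)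
    have htop : Module.finrank ℂ ↥(V i ⊔ ℂ ∙ u) = Module.finrank ℂ E := by
      rw [show V i ⊔ ℂ ∙ u = ⊤ from hi, finrank_top]
    have := hV i
    lia
  have hdense : Dense (⋂ i, (W i : Set E)ᶜ) :=
    dense_iInter_of_isOpen (fun i => (W i).closed_of_finiteDimensional.isOpen_compl) fun i =>
      interior_eq_empty_iff_dense_compl.1 <| Set.not_nonempty_iff_eq_empty.1 fun hne =>
        hW i ((W i).eq_top_of_nonempty_interior' hne)
  refine hdense.mono fun y hy s hs => ?_
  obtain ⟨i, hi⟩ := Set.mem_iUnion.1 hs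
  refine Set.mem_iInter.1 hy i ?_
  have hyi : y = (y + s • u) + (-s) • u := by module
  rw [hyi]
  exact Submodule.add_mem_sup hi (Submodule.smul_mem _ _ (Submodule.mem_span_singleton_self u))

end Lines

section Germs

open Filter Metric

variable {E : Type*} [NormedAddCommGroup E] [NormedSpace ℂ E]

lemma eventually_eq_zero_or_of_mul {f g : E → ℂ} {p : E} (hf : AnalyticAt ℂ f p)
    (hg : AnalyticAt ℂ g p) (hfg : ∀ᶠ x in 𝓝 p, f x * g x = 0) :
    (∀ᶠ x in 𝓝 p, f x = 0) ∨ ∀ᶠ x in 𝓝 p, g x = 0 := by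
  by_contra! h
  obtain ⟨hf0, hg0⟩ := h
  obtain ⟨ε, hε, hball⟩ := eventually_nhds_iff_ball.1
    (hf.eventually_analyticAt.and (hg.eventually_analyticAt.and hfg))
  obtain ⟨x, hx0, hx⟩ := (hf0.and_eventually (ball_mem_nhds p hε)).exists
  have hgx : g =ᶠ[𝓝 x] 0 := by
    filter_upwards [(hball x hx).1.continuousAt.eventually_ne hx0, isOpen_ball.mem_nhds hx]
      with y hy hyb
    exact (mul_eq_zero.1 (hball y hyb).2.2).resolve_left hy
  have hg_eq : Set.EqOn g 0 (ball p ε) :=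
    AnalyticOnNhd.eqOn_zero_of_preconnected_of_eventuallyEq_zero (fun y hy => (hball y hy).2.1)
      (convex_ball p ε).isPreconnected hx hgx
  exact hg0 ((ball_mem_nhds p hε |> eventually_mem_nhds_iff.2).mono
    fun y hy => not_not.2 (hg_eq (mem_of_mem_nhds hy)))

lemma exists_eventually_eq_zero_of_prod {ι : Type*} (s : Finset ι) {f : ι → E → ℂ} {p : E}
    (hf : ∀ i ∈ s, AnalyticAt ℂ (f i) p) (hprod : ∀ᶠ x in 𝓝 p, ∏ i ∈ s, f i x = 0) :
    ∃ i ∈ s, ∀ᶠ x in 𝓝 p, f i x = 0 := by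
  classical
  induction s using Finset.induction_on with
  | empty => simpa using hprod.self_of_nhds
  | insert i s hi ih =>
    simp only [Finset.prod_insert hi] at hprod
    have hs : ∀ j ∈ s, AnalyticAt ℂ (f j) p := fun j hj => hf j (Finset.mem_insert_of_mem hj)
    rcases eventually_eq_zero_or_of_mul (hf i (Finset.mem_insert_self i s))
      (Finset.analyticAt_fun_prod s hs) hprod with h | h
    · exact ⟨i, Finset.mem_insert_self i s, h⟩
    · obtain ⟨j, hj, hj0⟩ := ih hs h
      exact ⟨j, Finset.mem_insert_of_mem hj, hj0⟩

lemma exists_root_of_unity_mul {f g : E → ℂ} {p : E} {k : ℕ} (hk : k ≠ 0) (hf : AnalyticAt ℂ f p)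
    (hg : AnalyticAt ℂ g p) (hfg : ∀ᶠ x in 𝓝 p, f x ^ k = g x ^ k) :
    ∃ ζ : ℂ, ζ ^ k = 1 ∧ ∀ᶠ x in 𝓝 p, f x = ζ * g x := by
  have hpos := Nat.pos_of_ne_zero hk
  have hprod : ∀ᶠ x in 𝓝 p, ∏ ζ ∈ Polynomial.nthRootsFinset k (1 : ℂ), (f x - ζ * g x) = 0 := by
    filter_upwards [hfg] with x hx
    rw [← (Complex.isPrimitiveRoot_exp k hk).pow_sub_pow_eq_prod_sub_mul _ _ hpos, hx, sub_self]
  obtain ⟨ζ, hζ, h⟩ := exists_eventually_eq_zero_of_prod _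
    (fun ζ _ => hf.sub (analyticAt_const.mul hg)) hprod
  exact ⟨ζ, (Polynomial.mem_nthRootsFinset hpos _).1 hζ, h.mono fun x hx => sub_eq_zero.1 hx⟩

end Germs

section Jacobian

variable {ι : Type*} {f g : (ι → ℂ) → (ι → ℂ)} {x : ι → ℂ}

/-- The Jacobian determinant of a self-map of `ℂ^ι`. -/
def jac (f : (ι → ℂ) → (ι → ℂ)) (x : ι → ℂ) : ℂ := (fderiv ℂ f x).det

lemma surjective_fderiv_of_jac_ne_zero [Finite ι] (h0 : jac f x ≠ 0) :
    Function.Surjective (fderiv ℂ f x) := by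
  rw [← (fderiv ℂ f x).coe_toContinuousLinearEquivOfDetNeZero h0]
  exact ((fderiv ℂ f x).toContinuousLinearEquivOfDetNeZero h0).surjective

variable [Fintype ι]

lemma analyticAt_jac (hf : AnalyticAt ℂ f x) : AnalyticAt ℂ (jac f) x := by
  classical
  have hjac : jac f = fun y => ∑ σ : Equiv.Perm ι, ((Equiv.Perm.sign σ : ℤ) : ℂ) *
      ∏ i, fderiv ℂ f y (Pi.single i 1) (σ i) := by
    ext y
    rw [jac, ContinuousLinearMap.det, ← LinearMap.det_toMatrix', Matrix.det_apply']
    simp [LinearMap.toMatrix'_apply]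
  rw [hjac]
  refine Finset.analyticAt_fun_sum _ fun σ _ => analyticAt_const.mul
    (Finset.analyticAt_fun_prod _ fun i _ => ?_)
  exact analyticAt_pi_iff.1 (((ContinuousLinearMap.apply ℂ (ι → ℂ)
    (Pi.single i 1)).analyticAt _).comp hf.fderiv) (σ i)

lemma jac_comp (hg : AnalyticAt ℂ g (f x)) (hf : AnalyticAt ℂ f x) :
    jac (fun y => g (f y)) x = jac g (f x) * jac f x := by
  have hcomp : fderiv ℂ (fun y => g (f y)) x = (fderiv ℂ g (f x)).comp (fderiv ℂ f x) :=
    fderiv_comp x hg.differentiableAt hf.differentiableAt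
  rw [jac, hcomp]
  exact LinearMap.det_comp _ _

lemma jac_ne_zero_of_leftInverse (hf : AnalyticAt ℂ f x) (hg : AnalyticAt ℂ g (f x))
    (hgf : ∀ᶠ y in 𝓝 x, g (f y) = y) : jac f x ≠ 0 := by
  have h : jac g (f x) * jac f x = 1 := by
    rw [← jac_comp hg hf, jac, Filter.EventuallyEq.fderiv_eq (f := id) hgf, fderiv_id]
    exact LinearMap.det_id
  exact right_ne_zero_of_mul_eq_one h

lemma jac_mul_left (ζ : ι → ℂ) (hf : AnalyticAt ℂ f x) :
    jac (fun y => ζ * f y) x = (∏ i, ζ i) * jac f x := by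
  classical
  let D : (ι → ℂ) →L[ℂ] (ι → ℂ) :=
    LinearMap.toContinuousLinearMap (Matrix.toLin' (Matrix.diagonal ζ))
  have hD : ∀ v, ζ * v = D v := fun v => by ext i; simp [D, Matrix.mulVec_diagonal]
  have hdet : D.det = ∏ i, ζ i := by simp [D, ContinuousLinearMap.det, Matrix.det_diagonal]
  simp only [hD]
  rw [jac_comp (D.analyticAt _) hf, jac, D.fderiv, hdet]

lemma exists_localInverse_of_jac_ne_zero (hf : AnalyticAt ℂ f x) (h0 : jac f x ≠ 0) :
    ∃ e : OpenPartialHomeomorph (ι → ℂ) (ι → ℂ),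
      x ∈ e.source ∧ ⇑e = f ∧ AnalyticAt ℂ e.symm (f x) :=
  exists_analyticAt_localInverse hf ((fderiv ℂ f x).toContinuousLinearEquivOfDetNeZero h0)
    ((fderiv ℂ f x).coe_toContinuousLinearEquivOfDetNeZero h0).symm

end Jacobian

section LinearQuotient

open Metric Filter
open scoped Matrix

variable {d : ℕ} {G G' : Subgroup (Matrix.GeneralLinearGroup (Fin d) ℂ)}

lemma linearMk_eq_iff {v w : Fin d → ℂ} :
    linearMk G v = linearMk G w ↔ ∃ g ∈ G, w = g.1 *ᵥ v :=
  Quotient.eq (r := linearSetoid G)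

lemma linearMk_mulVec {g : Matrix.GeneralLinearGroup (Fin d) ℂ} (hg : g ∈ G) (v : Fin d → ℂ) :
    linearMk G (g.1 *ᵥ v) = linearMk G v :=
  (linearMk_eq_iff.2 ⟨g, hg, rfl⟩).symm

lemma linearMk_surjective : Function.Surjective (linearMk G) := Quotient.exists_rep

lemma continuous_linearMk : Continuous (linearMk G) := continuous_quotient_mk'

lemma inv_mulVec_mulVec (g : Matrix.GeneralLinearGroup (Fin d) ℂ) (v : Fin d → ℂ) :
    (g⁻¹).1 *ᵥ (g.1 *ᵥ v) = v := by
  rw [Matrix.mulVec_mulVec, ← Units.val_mul, inv_mul_cancel, Units.val_one, Matrix.one_mulVec]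

lemma analyticAt_mulVec (A : Matrix (Fin d) (Fin d) ℂ) (v : Fin d → ℂ) :
    AnalyticAt ℂ A.mulVec v :=
  (LinearMap.toContinuousLinearMap A.mulVecLin).analyticAt v

lemma continuous_mulVec (A : Matrix (Fin d) (Fin d) ℂ) : Continuous A.mulVec :=
  A.mulVecLin.continuous_of_finiteDimensional

lemma isOpenMap_linearMk : IsOpenMap (linearMk G) := by
  intro U hU
  have hpre : linearMk G ⁻¹' (linearMk G '' U) = ⋃ g ∈ G, (fun v => g.1 *ᵥ v) ⁻¹' U := by
    ext v
    simp only [Set.mem_preimage, Set.mem_image, Set.mem_iUnion]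
    constructor
    · rintro ⟨w, hw, hwv⟩
      obtain ⟨g, hg, rfl⟩ := linearMk_eq_iff.1 hwv
      exact ⟨g⁻¹, inv_mem hg, by rwa [inv_mulVec_mulVec]⟩
    · rintro ⟨g, hg, hw⟩
      exact ⟨_, hw, linearMk_mulVec hg v⟩
  change IsOpen (linearMk G ⁻¹' (linearMk G '' U))
  rw [hpre]
  exact isOpen_biUnion fun g _ => hU.preimage (continuous_mulVec g.1)

lemma exists_apply_linearMk_eq {P : (Fin d → ℂ) → ℂ} (hP : ∀ g ∈ G, ∀ v, P (g.1 *ᵥ v) = P v) :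
    ∃ q : LinearQuotient G → ℂ, ∀ v, q (linearMk G v) = P v :=
  ⟨Quotient.lift (s := linearSetoid G) P (by rintro v w ⟨g, hg, rfl⟩; exact (hP g hg v).symm),
    fun _ => rfl⟩

lemma exists_analytic_apply_ne (hG : Finite G) {x y : LinearQuotient G} (hxy : x ≠ y) :
    ∃ q : LinearQuotient G → ℂ, (∀ v, AnalyticAt ℂ (fun w => q (linearMk G w)) v) ∧ q x ≠ q y := by
  have := Fintype.ofFinite G
  obtain ⟨v, rfl⟩ := linearMk_surjective x
  obtain ⟨w, rfl⟩ := linearMk_surjective y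
  obtain ⟨ℓ, hℓ⟩ := Module.exists_dual_forall_apply_ne_zero (K := ℂ) (fun g : G => g.1.1 *ᵥ v - w)
    fun g hg => hxy (linearMk_eq_iff.2 ⟨g.1, g.2, (sub_eq_zero.1 hg).symm⟩)
  obtain ⟨q, hq⟩ := exists_apply_linearMk_eq (G := G)
    (P := fun u => ∏ g : G, ℓ (g.1.1 *ᵥ u - w)) fun h hh u => by
      refine Eq.trans ?_ (Equiv.prod_comp (Equiv.mulRight (⟨h, hh⟩ : G)) _)
      simp only [Matrix.mulVec_mulVec, Equiv.coe_mulRight, Subgroup.coe_mul, Units.val_mul]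
  refine ⟨q, fun u => ?_, ?_⟩
  · simp only [hq]
    exact Finset.analyticAt_fun_prod _ fun g _ => (ℓ.toContinuousLinearMap.analyticAt _).comp
      ((analyticAt_mulVec g.1.1 u).sub analyticAt_const)
  · have hw : ∏ g : G, ℓ (g.1.1 *ᵥ w - w) = 0 :=
      Finset.prod_eq_zero (Finset.mem_univ 1) (by simp [-map_sub])
    rw [hq, hq, hw]
    exact Finset.prod_ne_zero_iff.2 fun g _ => hℓ g

lemma LinearQuotient.HolAt.congr {h h' : LinearQuotient G → ℂ} {x : LinearQuotient G}
    (hh : HolAt G h x) (hev : h' =ᶠ[𝓝 x] h) : HolAt G h' x := by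
  rintro v rfl
  exact (hh v rfl).congr ((continuous_linearMk.continuousAt.eventually hev).mono
    fun w hw => hw.symm)

/-- The set of points of `ℂᵈ` with nontrivial stabilizer in `G`. -/
def fixedLocus (G : Subgroup (Matrix.GeneralLinearGroup (Fin d) ℂ)) : Set (Fin d → ℂ) :=
  {v | ∃ g ∈ G, g ≠ 1 ∧ g.1 *ᵥ v = v}

lemma IsFiniteSmall.finrank_lt (hG : IsFiniteSmall G) {g : Matrix.GeneralLinearGroup (Fin d) ℂ}
    (hg : g ∈ G) (h1 : g ≠ 1) : Module.finrank ℂ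
      (Module.End.eigenspace (Matrix.toLin' (g : Matrix (Fin d) (Fin d) ℂ)) 1) + 1 < d := by
  set V := Module.End.eigenspace (Matrix.toLin' (g : Matrix (Fin d) (Fin d) ℂ)) 1
  have hV : V ≠ ⊤ := by
    intro htop
    refine h1 (Units.ext (Matrix.toLin'.injective (LinearMap.ext fun v => ?_)))
    have hv : v ∈ V := htop ▸ Submodule.mem_top
    simpa using Module.End.mem_eigenspace_iff.1 hv
  have hlt := Submodule.finrank_lt hV
  rw [Module.finrank_fin_fun] at hlt
  have hne : Module.finrank ℂ V + 1 ≠ d := hG.2 g hg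
  lia

lemma IsFiniteSmall.isLineThin_fixedLocus (hG : IsFiniteSmall G) : IsLineThin (fixedLocus G) := by
  have := hG.1
  let V : {g : G // g ≠ 1} → Submodule ℂ (Fin d → ℂ) := fun g =>
    Module.End.eigenspace (Matrix.toLin' (g.1.1 : Matrix (Fin d) (Fin d) ℂ)) 1
  have hV : fixedLocus G = ⋃ g, (V g : Set (Fin d → ℂ)) := by
    ext v
    simp only [fixedLocus, Set.mem_ofPred_eq, Set.mem_iUnion, V, SetLike.mem_coe,
      Module.End.mem_eigenspace_iff, Matrix.toLin'_apply, one_smul]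
    exact ⟨fun ⟨g, hg, hg1, hv⟩ => ⟨⟨⟨g, hg⟩, fun h => hg1 (congrArg Subtype.val h)⟩, hv⟩,
      fun ⟨g, hv⟩ => ⟨g.1.1, g.1.2, fun h => g.2 (Subtype.ext h), hv⟩⟩
  rw [hV]
  refine isLineThin_iUnion_submodule V fun g => ?_
  rw [Module.finrank_fin_fun]
  exact hG.finrank_lt g.1.2 fun h => g.2 (Subtype.ext h)

lemma exists_isOpen_injOn_linearMk (hG : Finite G) {a : Fin d → ℂ} (ha : a ∉ fixedLocus G) :
    ∃ V : Set (Fin d → ℂ), IsOpen V ∧ a ∈ V ∧ Set.InjOn (linearMk G) V := by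
  have hne : ∀ᶠ q : (Fin d → ℂ) × (Fin d → ℂ) in 𝓝 a ×ˢ 𝓝 a, ∀ g : G, g ≠ 1 →
      g.1.1 *ᵥ q.1 ≠ q.2 := by
    rw [← nhds_prod_eq]
    refine eventually_all.2 fun g => ?_
    by_cases hg : g = 1
    · simp [hg]
    · have hga : g.1.1 *ᵥ a ≠ a := fun h => ha ⟨g.1, g.2, fun h' => hg (Subtype.ext h'), h⟩
      have hc : Continuous fun q : (Fin d → ℂ) × (Fin d → ℂ) => g.1.1 *ᵥ q.1 :=
        (continuous_mulVec g.1.1).comp continuous_fst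
      exact ((hc.continuousAt.ne_iff_eventually_ne continuous_snd.continuousAt).1 hga).mono
        fun q hq _ => hq
  obtain ⟨W, hW, hWG⟩ := (eventually_prod_self_iff (r := fun v w => ∀ g : G, g ≠ 1 →
    g.1.1 *ᵥ v ≠ w)).1 hne
  obtain ⟨V, hVW, hVo, haV⟩ := _root_.mem_nhds_iff.1 hW
  refine ⟨V, hVo, haV, fun v hv w hw hvw => ?_⟩
  obtain ⟨g, hg, rfl⟩ := linearMk_eq_iff.1 hvw
  by_cases hg1 : g = 1
  · simp [hg1]
  · exact absurd rfl (hWG v (hVW hv) _ (hVW hw) ⟨g, hg⟩ fun h => hg1 (congrArg Subtype.val h))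

lemma exists_holomorphic_section (hG : Finite G) {a : Fin d → ℂ} (ha : a ∉ fixedLocus G) :
    ∃ (s : LinearQuotient G → Fin d → ℂ) (V : Set (Fin d → ℂ)), IsOpen V ∧ a ∈ V ∧
      ∀ v ∈ V, s (linearMk G v) = v ∧
        ∀ i, LinearQuotient.HolAt G (fun x => s x i) (linearMk G v) := by
  obtain ⟨V, hVo, haV, hinj⟩ := exists_isOpen_injOn_linearMk hG ha
  have hs : ∀ v ∈ V, Function.invFunOn (linearMk G) V (linearMk G v) = v :=
    hinj.leftInvOn_invFunOn
  refine ⟨Function.invFunOn (linearMk G) V, V, hVo, haV, fun v hv => ⟨hs v hv, fun i w hw => ?_⟩⟩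
  obtain ⟨g, hg, rfl⟩ := linearMk_eq_iff.1 hw
  refine (analyticAt_pi_iff.1 (analyticAt_mulVec g.1 w) i).congr ?_
  filter_upwards [(continuous_mulVec g.1).continuousAt.eventually (hVo.mem_nhds hv)] with x hx
  rw [← linearMk_mulVec hg x, hs _ hx]

/-- The local homeomorphism `θ` between linear quotients is biholomorphic: it identifies the
structure sheaves. -/
def IsHolIso (θ : OpenPartialHomeomorph (LinearQuotient G) (LinearQuotient G')) : Prop :=
  ∀ x ∈ θ.source, ∀ q : LinearQuotient G' → ℂ,
    LinearQuotient.HolAt G' q (θ x) ↔ LinearQuotient.HolAt G (fun y => q (θ y)) x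

namespace IsHolIso

variable {θ : OpenPartialHomeomorph (LinearQuotient G) (LinearQuotient G')}

lemma symm (hθ : IsHolIso θ) : IsHolIso θ.symm := by
  intro y hy q
  have hiff := hθ (θ.symm y) (θ.map_target hy) (fun x => q (θ.symm x))
  rw [θ.right_inv hy] at hiff
  rw [hiff]
  have hq : (fun x => q (θ.symm (θ x))) =ᶠ[𝓝 (θ.symm y)] q := by
    filter_upwards [θ.open_source.mem_nhds (θ.map_target hy)] with x hx
    rw [θ.left_inv hx]
  exact ⟨fun h => h.congr hq, fun h => h.congr hq.symm⟩

lemma analyticAt_pullback (hθ : IsHolIso θ) {q : LinearQuotient G' → ℂ} {a : Fin d → ℂ}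
    (hq : ∀ v, AnalyticAt ℂ (fun w => q (linearMk G' w)) v) (ha : linearMk G a ∈ θ.source) :
    AnalyticAt ℂ (fun x => q (θ (linearMk G x))) a :=
  (hθ _ ha q).1 (fun v _ => hq v) a rfl

lemma exists_lift (hθ : IsHolIso θ) (hG' : Finite G') {a b : Fin d → ℂ}
    (ha : linearMk G a ∈ θ.source) (hab : θ (linearMk G a) = linearMk G' b)
    (hb : b ∉ fixedLocus G') :
    ∃ β : (Fin d → ℂ) → (Fin d → ℂ), AnalyticAt ℂ β a ∧ β a = b ∧
      (∀ᶠ x in 𝓝 a, linearMk G' (β x) = θ (linearMk G x)) ∧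
      (∀ᶠ y in 𝓝 b, ∀ x, θ (linearMk G x) = linearMk G' y → β x = y) ∧
      ∀ x x', linearMk G x = linearMk G x' → β x = β x' := by
  obtain ⟨s, V, hVo, hbV, hV⟩ := exists_holomorphic_section hG' hb
  refine ⟨fun x => s (θ (linearMk G x)), analyticAt_pi_iff.2 fun i => ?_, ?_, ?_, ?_,
    fun x x' h => congrArg (fun y => s (θ y)) h⟩
  · exact (hθ _ ha fun x => s x i).1 (hab ▸ (hV b hbV).2 i) a rfl
  · simp only [hab, (hV b hbV).1]
  · have hVθ : linearMk G' '' V ∈ 𝓝 (θ (linearMk G a)) :=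
      hab ▸ (isOpenMap_linearMk V hVo).mem_nhds ⟨b, hbV, rfl⟩
    have hc : ContinuousAt (fun x => θ (linearMk G x)) a :=
      ContinuousAt.comp (g := θ) (θ.continuousAt ha) continuous_linearMk.continuousAt
    filter_upwards [hc.preimage_mem_nhds hVθ] with x ⟨v, hv, hvx⟩
    simp only at hvx
    rw [← hvx, (hV v hv).1]
  · filter_upwards [hVo.mem_nhds hbV] with y hy x hx
    rw [hx, (hV y hy).1]

lemma eventually_mem_source {a : Fin d → ℂ} (ha : linearMk G a ∈ θ.source) :
    ∀ᶠ x in 𝓝 a, linearMk G x ∈ θ.source :=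
  continuous_linearMk.continuousAt.eventually (θ.open_source.mem_nhds ha)

lemma jac_lift_ne_zero (hθ : IsHolIso θ) (hG : Finite G) {a : Fin d → ℂ}
    {β : (Fin d → ℂ) → (Fin d → ℂ)} (ha : linearMk G a ∈ θ.source) (haG : a ∉ fixedLocus G)
    (hβ : AnalyticAt ℂ β a) (hβθ : ∀ᶠ x in 𝓝 a, linearMk G' (β x) = θ (linearMk G x)) :
    jac β a ≠ 0 := by
  have hβa := hβθ.self_of_nhds
  have hb : linearMk G' (β a) ∈ θ.symm.source := by rw [hβa]; exact θ.map_source ha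
  obtain ⟨π, hπ, -, -, hπa, -⟩ := hθ.symm.exists_lift hG hb (by rw [hβa, θ.left_inv ha]) haG
  refine jac_ne_zero_of_leftInverse hβ hπ ?_
  filter_upwards [hβθ, hπa, eventually_mem_source ha] with x hx hxπ hxs
  exact hxπ _ (by rw [hx, θ.left_inv hxs])

/-- The inverse of `θ` lifts to a `π` near `b`, whose Jacobian cannot vanish off the small set
`fixedLocus G'`, hence not at all; an injective `π` separates the points of `G'`-orbits near `b`. -/
lemma notMem_fixedLocus (hθ : IsHolIso θ) (hG : Finite G) (hG' : IsFiniteSmall G')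
    {a b : Fin d → ℂ} (ha : linearMk G a ∈ θ.source) (hab : θ (linearMk G a) = linearMk G' b)
    (haG : a ∉ fixedLocus G) : b ∉ fixedLocus G' := by
  have hb : linearMk G' b ∈ θ.symm.source := by rw [← hab]; exact θ.map_source ha
  obtain ⟨π, hπ, -, hπθ, -, hπG⟩ := hθ.symm.exists_lift hG hb (by rw [← hab, θ.left_inv ha]) haG
  have hJ : jac π b ≠ 0 := by
    refine hG'.isLineThin_fixedLocus.ne_zero (analyticAt_jac hπ) ?_
    filter_upwards [hπ.eventually_analyticAt, hπθ.eventually_nhds, eventually_mem_source hb]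
      with y hy hyθ hys hyG
    exact hθ.symm.jac_lift_ne_zero hG'.1 hys hyG hy hyθ
  obtain ⟨e, hbe, heπ, -⟩ := exists_localInverse_of_jac_ne_zero hπ hJ
  rintro ⟨g, hg, hg1, hgb⟩
  have hsource : ∀ᶠ y in 𝓝 b, y ∈ e.source := e.open_source.mem_nhds hbe
  have hgsource : ∀ᶠ y in 𝓝 b, g.1 *ᵥ y ∈ e.source :=
    (continuous_mulVec g.1).continuousAt.eventually (by rwa [hgb])
  obtain ⟨y, hyG, hy, hgy⟩ :=
    ((hG'.isLineThin_fixedLocus.frequently_notMem b).and_eventually (hsource.and hgsource)).exists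
  refine hyG ⟨g, hg, hg1, e.injOn hgy hy ?_⟩
  rw [heπ]
  exact hπG _ _ (linearMk_mulVec hg y)

lemma exists_lift_eq_mul (hθ : IsHolIso θ) (hG : Finite G) (hG' : IsFiniteSmall G') {k : ℕ}
    (hk : k ≠ 0) {Y : (Fin d → ℂ) → (Fin d → ℂ)} {a : Fin d → ℂ} (ha : linearMk G a ∈ θ.source)
    (haG : a ∉ fixedLocus G) (hY : AnalyticAt ℂ Y a)
    (hYk : ∀ᶠ x in 𝓝 a, ∀ b, θ (linearMk G x) = linearMk G' b → Y x ^ k = b ^ k) :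
    ∃ (β : (Fin d → ℂ) → (Fin d → ℂ)) (ζ : Fin d → ℂ), AnalyticAt ℂ β a ∧ jac β a ≠ 0 ∧
      ζ ^ k = 1 ∧ (∀ᶠ x in 𝓝 a, linearMk G' (β x) = θ (linearMk G x)) ∧
        Y =ᶠ[𝓝 a] fun x => ζ * β x := by
  obtain ⟨b, hb⟩ := linearMk_surjective (θ (linearMk G a))
  obtain ⟨β, hβ, -, hβθ, -⟩ :=
    hθ.exists_lift hG'.1 ha hb.symm (hθ.notMem_fixedLocus hG hG' ha hb.symm haG)
  have hroot : ∀ i, ∃ ζ : ℂ, ζ ^ k = 1 ∧ ∀ᶠ x in 𝓝 a, Y x i = ζ * β x i := fun i => by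
    refine exists_root_of_unity_mul hk (analyticAt_pi_iff.1 hY i) (analyticAt_pi_iff.1 hβ i) ?_
    filter_upwards [hYk, hβθ] with x hx hxβ
    exact congrFun (hx _ hxβ.symm) i
  choose ζ hζ hYζ using hroot
  exact ⟨β, ζ, hβ, hθ.jac_lift_ne_zero hG ha haG hβ hβθ, funext hζ, hβθ,
    (eventually_all.2 hYζ).mono fun x hx => funext hx⟩

lemma exists_pow_eq_pullback (hθ : IsHolIso θ) (hG : IsFiniteSmall G) (hG' : IsFiniteSmall G')
    {a : Fin d → ℂ} (ha : linearMk G a ∈ θ.source) {k : ℕ} (hk : k ≠ 0)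
    (hdiag : ∀ g ∈ G', ∀ v, (g.1 *ᵥ v) ^ k = v ^ k) :
    ∃ Y : (Fin d → ℂ) → (Fin d → ℂ), AnalyticAt ℂ Y a ∧
      ∀ᶠ x in 𝓝 a, ∀ b, θ (linearMk G x) = linearMk G' b → Y x ^ k = b ^ k := by
  choose q hq using fun i => exists_apply_linearMk_eq (G := G') (P := fun v => v i ^ k)
    fun g hg v => congrFun (hdiag g hg v) i
  have hqan : ∀ i v, AnalyticAt ℂ (fun w => q i (linearMk G' w)) v := fun i v => by
    simp only [hq]
    exact ((ContinuousLinearMap.proj (R := ℂ) i).analyticAt v).pow k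
  have hroot : ∀ i, ∃ Y : (Fin d → ℂ) → ℂ, AnalyticAt ℂ Y a ∧
      ∀ᶠ x in 𝓝 a, Y x ^ k = q i (θ (linearMk G x)) := fun i => by
    refine hG.isLineThin_fixedLocus.exists_pow_eq hk (hθ.analyticAt_pullback (hqan i) ha) ?_
    filter_upwards [eventually_mem_source ha] with x hx hxG
    obtain ⟨b, hb⟩ := linearMk_surjective (θ (linearMk G x))
    obtain ⟨β, hβ, -, hβθ, -⟩ :=
      hθ.exists_lift hG'.1 hx hb.symm (hθ.notMem_fixedLocus hG.1 hG' hx hb.symm hxG)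
    exact ⟨fun y => β y i, analyticAt_pi_iff.1 hβ i, hβθ.mono fun y hy =>
      (congrArg (q i) hy).symm.trans (hq i (β y))⟩
  choose Y hY hYk using hroot
  refine ⟨fun x i => Y i x, analyticAt_pi_iff.2 hY, (eventually_all.2 hYk).mono fun x hx b hb => ?_⟩
  ext i
  rw [Pi.pow_apply, hx i, hb, hq, Pi.pow_apply]

/-- After rescaling by roots of unity, the `k`-th roots of the pulled back functions `vᵢ ^ k` agree
with a local lift of `θ` at one point of the ball, hence lift `θ` on the whole ball. -/
theorem exists_biholomorphic_lift (hθ : IsHolIso θ) (hG : IsFiniteSmall G)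
    (hG' : IsFiniteSmall G') {a : Fin d → ℂ} (ha : linearMk G a ∈ θ.source) {k : ℕ} (hk : k ≠ 0)
    (hdiag : ∀ g ∈ G', ∀ v, (g.1 *ᵥ v) ^ k = v ^ k) :
    ∃ Ψ : (Fin d → ℂ) → (Fin d → ℂ), AnalyticAt ℂ Ψ a ∧ jac Ψ a ≠ 0 ∧
      ∀ᶠ x in 𝓝 a, θ (linearMk G x) = linearMk G' (Ψ x) := by
  obtain ⟨Y, hY, hYk⟩ := hθ.exists_pow_eq_pullback hG hG' ha hk hdiag
  have hprod : ∀ {ζ : Fin d → ℂ}, ζ ^ k = 1 → ∏ i, ζ i ≠ 0 := fun hζ =>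
    Finset.prod_ne_zero_iff.2 fun i _ h0 => by simpa [h0, hk] using congrFun hζ i
  have hthin := hG.isLineThin_fixedLocus
  have hnear : ∀ᶠ x in 𝓝 a, AnalyticAt ℂ Y x ∧ linearMk G x ∈ θ.source ∧
      ∀ᶠ y in 𝓝 x, ∀ b, θ (linearMk G y) = linearMk G' b → Y y ^ k = b ^ k :=
    hY.eventually_analyticAt.and ((eventually_mem_source ha).and hYk.eventually_nhds)
  have hYjac : jac Y a ≠ 0 := by
    refine hthin.ne_zero (analyticAt_jac hY) (hnear.mono fun x ⟨hYx, hxs, hxk⟩ hxG => ?_)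
    obtain ⟨β, ζ, hβ, hβj, hζ, -, hYβ⟩ := hθ.exists_lift_eq_mul hG.1 hG' hk hxs hxG hYx hxk
    rw [jac, hYβ.fderiv_eq, ← jac, jac_mul_left ζ hβ]
    exact mul_ne_zero (hprod hζ) hβj
  obtain ⟨ε, hε, hball⟩ := eventually_nhds_iff_ball.1 hnear
  obtain ⟨x₀, hx₀G, hx₀⟩ :=
    ((hthin.frequently_notMem a).and_eventually (ball_mem_nhds a hε)).exists
  obtain ⟨hYx₀, hx₀s, hx₀k⟩ := hball x₀ hx₀
  obtain ⟨β, ζ, -, -, hζ, hβθ, hYβ⟩ := hθ.exists_lift_eq_mul hG.1 hG' hk hx₀s hx₀G hYx₀ hx₀k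
  have hmul : ∀ {x}, AnalyticAt ℂ Y x → AnalyticAt ℂ (fun y => ζ⁻¹ * Y y) x := fun h =>
    analyticAt_const.mul h
  have hζ0 : ζ⁻¹ * ζ = 1 := funext fun i => inv_mul_cancel₀
    (Finset.prod_ne_zero_iff.1 (hprod hζ) i (Finset.mem_univ i))
  refine ⟨fun x => ζ⁻¹ * Y x, hmul hY, ?_, ?_⟩
  · rw [jac_mul_left _ hY]
    exact mul_ne_zero (hprod (by rw [inv_pow, hζ, inv_one])) hYjac
  · filter_upwards [ball_mem_nhds a hε] with x hx
    by_contra hne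
    obtain ⟨q, hq, hqne⟩ := exists_analytic_apply_ne hG'.1 hne
    refine hqne (AnalyticOnNhd.eqOn_of_preconnected_of_eventuallyEq
      (f := fun x => q (θ (linearMk G x))) (g := fun x => q (linearMk G' (ζ⁻¹ * Y x)))
      (fun y hy => hθ.analyticAt_pullback hq (hball y hy).2.1)
      (fun y hy => (hq _).comp (hmul (hball y hy).1)) (convex_ball a ε).isPreconnected hx₀ ?_ hx)
    filter_upwards [hβθ, hYβ] with y hyθ hyβ
    rw [← hyθ, hyβ, ← mul_assoc, hζ0, one_mul]

end IsHolIso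

end LinearQuotient

section Smooth

open Filter

variable {ι κ : Type*} [Fintype ι] [Fintype κ]

lemma IsSmoothAt.of_submersion {S : Set (ι → ℂ)} {T : Set (κ → ℂ)} {ψ : (κ → ℂ) → (ι → ℂ)}
    {p : κ → ℂ} (hψ : AnalyticAt ℂ ψ p) (hsurj : Function.Surjective (fderiv ℂ ψ p))
    (hS : IsSmoothAt S (ψ p)) (hT : ∀ᶠ z in 𝓝 p, z ∈ T ↔ ψ z ∈ S) : IsSmoothAt T p := by
  obtain ⟨r, H, hH, hHs, hHS⟩ := hS
  refine ⟨r, fun z => H (ψ z), hH.comp hψ, ?_, ?_⟩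
  · have hcomp : fderiv ℂ (fun z => H (ψ z)) p = (fderiv ℂ H (ψ p)).comp (fderiv ℂ ψ p) :=
      fderiv_comp p hH.differentiableAt hψ.differentiableAt
    rw [hcomp]
    exact hHs.comp hsurj
  · filter_upwards [hT, hψ.continuousAt.eventually hHS] with z hz hzS
    rw [hz, hzS]

lemma IsSmoothAt.image {S T : Set (ι → ℂ)} {ψ : (ι → ℂ) → (ι → ℂ)} {p : ι → ℂ}
    (hS : IsSmoothAt S p) (hψ : AnalyticAt ℂ ψ p) (hj : jac ψ p ≠ 0)
    (hST : ∀ᶠ z in 𝓝 p, z ∈ S ↔ ψ z ∈ T) : IsSmoothAt T (ψ p) := by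
  obtain ⟨e, hpe, rfl, hes⟩ := exists_localInverse_of_jac_ne_zero hψ hj
  have hpt : e p ∈ e.target := e.map_source hpe
  have hsp : e.symm (e p) = p := e.left_inv hpe
  have hjs : jac e.symm (e p) ≠ 0 := jac_ne_zero_of_leftInverse hes (by rwa [hsp])
    ((e.open_target.mem_nhds hpt |> eventually_mem_nhds_iff.2).mono
      fun y hy => e.right_inv (mem_of_mem_nhds hy))
  refine IsSmoothAt.of_submersion (S := S) hes (surjective_fderiv_of_jac_ne_zero hjs)
    (by rwa [hsp]) ?_
  filter_upwards [hes.continuousAt.eventually (by rwa [hsp]), e.open_target.mem_nhds hpt]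
    with z hz hzt
  rw [hz, e.right_inv hzt]

end Smooth

section Cones

open Filter

variable {N : Type*} [AddCommGroup N] {s : Finset N}

lemma IsIntegralGenerators.linearIndependent (hs : IsIntegralGenerators s) :
    LinearIndependent ℤ (fun e : s => (e : N)) :=
  hs.1.comp (fun e : s => (⟨e.1, e.2⟩ : (s : Set N)))
    fun _ _ h => Subtype.ext (congrArg Subtype.val h)

lemma IsIntegralGenerators.linearIndependent_real (hs : IsIntegralGenerators s) :
    LinearIndependent ℝ (fun e : s => (1 : ℝ) ⊗ₜ[ℤ] (e : N)) :=
  Module.Flat.linearIndependent_one_tmul hs.linearIndependent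

lemma cone_subset_span (s : Finset N) :
    cone s ⊆ Submodule.span ℝ (Set.range fun e : s => (1 : ℝ) ⊗ₜ[ℤ] (e : N)) := by
  rintro x ⟨μ, -, rfl⟩
  exact Submodule.sum_mem _ fun e he =>
    Submodule.smul_mem _ _ (Submodule.subset_span ⟨⟨e, he⟩, rfl⟩)

lemma mem_cone_iff_repr_nonneg (b : Module.Basis s ℝ (ℝ ⊗[ℤ] N))
    (hb : ∀ e : s, b e = (1 : ℝ) ⊗ₜ[ℤ] (e : N)) {x : ℝ ⊗[ℤ] N} :
    x ∈ cone s ↔ ∀ e, 0 ≤ b.repr x e := by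
  classical
  constructor
  · rintro ⟨μ, hμ, rfl⟩ e
    rw [← Finset.sum_coe_sort]
    simp only [← hb]
    rw [b.repr_sum_self]
    exact hμ e e.2
  · intro hx
    refine ⟨fun e => if h : e ∈ s then b.repr x ⟨e, h⟩ else 0, fun e he => ?_, ?_⟩
    · simpa only [dif_pos he] using hx ⟨e, he⟩
    · rw [← Finset.sum_coe_sort]
      conv_lhs => rw [← b.sum_repr x]
      simp [hb]

lemma IsIntegralGenerators.subset_of_sum_mem_cone (hs : IsIntegralGenerators s) {u : Finset N}
    (hus : u ⊆ s) (h : ∑ e ∈ s, (1 : ℝ) ⊗ₜ[ℤ] e ∈ cone u) : s ⊆ u := by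
  classical
  obtain ⟨μ, -, hμ⟩ := h
  intro e he
  by_contra heu
  have hrel : ∑ e : s, ((if (e : N) ∈ u then μ e else 0) - 1) • ((1 : ℝ) ⊗ₜ[ℤ] (e : N)) = 0 := by
    rw [Finset.sum_coe_sort s fun e => ((if e ∈ u then μ e else 0) - 1) • ((1 : ℝ) ⊗ₜ[ℤ] e)]
    simp only [sub_smul, one_smul, ite_smul, zero_smul, Finset.sum_sub_distrib]
    rw [Finset.sum_ite_mem, Finset.inter_eq_right.2 hus, ← hμ, sub_self]
  have := Fintype.linearIndependent_iff.1 hs.linearIndependent_real _ hrel ⟨e, he⟩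
  simp [heu] at this

lemma mem_submodule_of_frequently {V : Type*} [AddCommGroup V] [Module ℝ V] {W : Submodule ℝ V}
    {x y : V} (h : ∃ᶠ n : ℕ in atTop, x + ((n : ℝ) + 1)⁻¹ • y ∈ W) : y ∈ W := by
  obtain ⟨n, hn⟩ := h.exists
  obtain ⟨m, hm, hnm⟩ := (h.and_eventually (eventually_gt_atTop n)).exists
  have hdiff : (((n : ℝ) + 1)⁻¹ - ((m : ℝ) + 1)⁻¹) • y ∈ W := by
    convert W.sub_mem hn hm using 1
    module
  refine (W.smul_mem_iff (sub_ne_zero.2 fun h => ?_)).1 hdiff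
  have : (n : ℝ) = m := by simpa using h
  exact hnm.ne (by exact_mod_cast this)

lemma finrank_real_tensor [Module.Free ℤ N] : Module.finrank ℝ (ℝ ⊗[ℤ] N) = Module.finrank ℤ N :=
  Module.finrank_baseChange

lemma Fan.exists_card_eq_finrank_of_mem_span [Module.Free ℤ N] (F : Fan N) :
    ∃ y : ℝ ⊗[ℤ] N, ∀ t ∈ F.cones,
      y ∈ Submodule.span ℝ (Set.range fun e : t => (1 : ℝ) ⊗ₜ[ℤ] (e : N)) →
        t.card = Module.finrank ℤ N := by
  have : Finite F.cones := F.finite_cones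
  by_contra! hcon
  let W (t : {t : F.cones // t.1.card ≠ Module.finrank ℤ N}) : Submodule ℝ (ℝ ⊗[ℤ] N) :=
    Submodule.span ℝ (Set.range fun e : t.1.1 => (1 : ℝ) ⊗ₜ[ℤ] (e : N))
  have hcover : ⋃ t, (W t : Set (ℝ ⊗[ℤ] N)) = Set.univ := by
    refine Set.eq_univ_of_forall fun y => ?_
    obtain ⟨t, ht, hyt, hcard⟩ := hcon y
    exact Set.mem_iUnion.2 ⟨⟨⟨t, ht⟩, hcard⟩, hyt⟩
  obtain ⟨t, ht⟩ := Subspace.exists_eq_top_of_iUnion_eq_univ hcover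
  have hspan := finrank_span_eq_card (F.generators t.1.1 t.1.2).linearIndependent_real
  rw [show Submodule.span ℝ _ = ⊤ from ht, finrank_top, finrank_real_tensor,
    Fintype.card_coe] at hspan
  exact t.2 hspan.symm

variable [Module.Free ℤ N] [Module.Finite ℤ N]

lemma IsIntegralGenerators.exists_basis_real (hs : IsIntegralGenerators s)
    (hcard : s.card = Module.finrank ℤ N) :
    ∃ b : Module.Basis s ℝ (ℝ ⊗[ℤ] N), ∀ e : s, b e = (1 : ℝ) ⊗ₜ[ℤ] (e : N) := by
  have hspan := hs.linearIndependent_real.span_eq_top_of_card_eq_finrank'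
    (by rw [Fintype.card_coe, hcard, finrank_real_tensor])
  exact ⟨.mk hs.linearIndependent_real hspan.ge, fun e => Module.Basis.mk_apply _ _ e⟩

lemma IsIntegralGenerators.mem_cone_of_frequently (hs : IsIntegralGenerators s)
    (hcard : s.card = Module.finrank ℤ N) {x y : ℝ ⊗[ℤ] N}
    (h : ∃ᶠ n : ℕ in atTop, x + ((n : ℝ) + 1)⁻¹ • y ∈ cone s) : x ∈ cone s := by
  obtain ⟨b, hb⟩ := hs.exists_basis_real hcard
  refine (mem_cone_iff_repr_nonneg b hb).2 fun e => ?_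
  have hlim : Tendsto (fun n : ℕ => b.repr x e + ((n : ℝ) + 1)⁻¹ * b.repr y e) atTop
      (𝓝 (b.repr x e + 0 * b.repr y e)) := by
    simp only [← one_div]
    exact (tendsto_one_div_add_atTop_nhds_zero_nat.mul_const _).const_add _
  rw [zero_mul, add_zero] at hlim
  refine ge_of_tendsto_of_frequently hlim (h.mono fun n hn => ?_)
  simpa using (mem_cone_iff_repr_nonneg b hb).1 hn e

/-- Perturbing an interior point `x` of the cone in a generic direction `y` leads into a cone
of full dimension, which is closed and hence contains `x`. -/
theorem Fan.exists_full_cone (F : Fan N) (hs : s ∈ F.cones) :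
    ∃ τ ∈ F.cones, s ⊆ τ ∧ τ.card = Module.finrank ℤ N := by
  obtain ⟨y, hy⟩ := F.exists_card_eq_finrank_of_mem_span
  set x : ℝ ⊗[ℤ] N := ∑ e ∈ s, (1 : ℝ) ⊗ₜ[ℤ] e with hx
  obtain ⟨τ, hτ, hfreq⟩ : ∃ τ ∈ F.cones, ∃ᶠ n : ℕ in atTop, x + ((n : ℝ) + 1)⁻¹ • y ∈ cone τ := by
    by_contra! hcon
    obtain ⟨n, hn⟩ := ((eventually_all_finite F.finite_cones).2
      hcon).exists
    have hmem : x + ((n : ℝ) + 1)⁻¹ • y ∈ ⋃ t ∈ F.cones, cone t := F.complete ▸ Set.mem_univ _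
    obtain ⟨t, ht, hxt⟩ := Set.mem_iUnion₂.1 hmem
    exact hn t ht hxt
  have hcard := hy τ hτ (mem_submodule_of_frequently (hfreq.mono fun n hn => cone_subset_span τ hn))
  have hxτ : x ∈ cone τ := (F.generators τ hτ).mem_cone_of_frequently hcard hfreq
  have hxs : x ∈ cone s := ⟨fun _ => 1, fun _ _ => zero_le_one, by simp [hx]⟩
  obtain ⟨u, hus, huτ, hu⟩ := F.inter_face s hs τ hτ
  have hxu : x ∈ cone u := hu ▸ ⟨hxs, hxτ⟩
  exact ⟨τ, hτ, ((F.generators s hs).subset_of_sum_mem_cone hus hxu).trans huτ, hcard⟩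

end Cones

section Generators

variable {N : Type*} [AddCommGroup N] [Module.Free ℤ N] {s : Finset N}

lemma exists_nsmul_eq_of_forall_dvd_dual {e : N} {b : ℕ}
    (h : ∀ m : Module.Dual ℤ N, (b : ℤ) ∣ m e) : ∃ v : N, b • v = e := by
  let B := Module.Free.chooseBasis ℤ N
  choose q hq using fun i => h (B.coord i)
  refine ⟨∑ i ∈ (B.repr e).support, q i • B i, ?_⟩
  conv_rhs => rw [← B.linearCombination_repr e, Finsupp.linearCombination_apply, Finsupp.sum]
  rw [Finset.smul_sum]
  refine Finset.sum_congr rfl fun i _ => ?_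
  rw [← natCast_zsmul, smul_smul, ← hq, Module.Basis.coord_apply]

lemma IsIntegralGenerators.eq_one_of_dvd_dual (hs : IsIntegralGenerators s) {e : N}
    (he : e ∈ s) {b : ℕ} (hb : 0 < b) (h : ∀ m : Module.Dual ℤ N, (b : ℤ) ∣ m e) : b = 1 := by
  obtain ⟨v, hv⟩ := exists_nsmul_eq_of_forall_dvd_dual h
  exact Nat.dvd_one.1 (hs.2 e he 1 b hb ⟨v, by rw [hv, one_smul]⟩)

variable [Module.Finite ℤ N]

lemma IsIntegralGenerators.exists_coords (hs : IsIntegralGenerators s)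
    (hcard : s.card = Module.finrank ℤ N) : ∃ (k : ℕ) (κ : s → Module.Dual ℤ N), k ≠ 0 ∧
      (∀ v, (k : ℤ) • v = ∑ e, κ e v • (e : N)) ∧
        (∀ e, κ e e = k) ∧ Pairwise fun e e' : s => κ e e' = 0 := by
  let P := Submodule.span ℤ (Set.range fun e : s => (e : N))
  let B : Module.Basis s ℤ P := .span hs.linearIndependent
  have hB (e) : (B e : N) = e := congrArg Subtype.val (Module.Basis.span_apply _ e)
  have := P.finiteQuotientOfFreeOfRankEq
    (by rw [Module.finrank_eq_card_basis B, Fintype.card_coe, hcard])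
  let k := Nat.card (N ⧸ P)
  have hkP (v : N) : (k : ℤ) • v ∈ P := by
    rw [← Submodule.Quotient.mk_eq_zero, Submodule.Quotient.mk_smul, natCast_zsmul]
    exact card_nsmul_eq_zero'
  let mulk : N →ₗ[ℤ] P := LinearMap.codRestrict P ((k : ℤ) • LinearMap.id) hkP
  have hmulk (e : s) : mulk e = (k : ℤ) • B e :=
    Subtype.ext (by rw [Submodule.coe_smul, hB]; rfl)
  refine ⟨k, fun e => B.coord e ∘ₗ mulk, Nat.card_pos.ne', fun v => ?_, fun e => ?_,
    fun e e' he => ?_⟩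
  · have h := congrArg Subtype.val (B.sum_repr (mulk v))
    simp only [Submodule.coe_sum, Submodule.coe_smul, hB] at h
    exact h.symm
  · simp [hmulk]
  · simp [hmulk, Finsupp.single_eq_of_ne he]

end Generators

section Torus

variable {N : Type*} [AddCommGroup N] {F : Fan N}

lemma mem_groupD {c : Ray F → ℂˣ} :
    c ∈ groupD F ↔ ∀ m : Module.Dual ℤ N, ∏ i, c i ^ m i.gen = 1 := Iff.rfl

lemma units_smul_apply (c : Ray F → ℂˣ) (z : Ray F → ℂ) (i : Ray F) :
    (c • z) i = (c i : ℂ) * z i := rfl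

lemma analyticAt_units_smul (c : Ray F → ℂˣ) (z : Ray F → ℂ) :
    AnalyticAt ℂ (fun w : Ray F → ℂ => c • w) z :=
  analyticAt_pi_iff.2 fun i =>
    analyticAt_const.mul (analyticAt_pi_iff.1 analyticAt_id i)

lemma mem_exceptionalSet_iff {z : Ray F → ℂ} :
    z ∈ exceptionalSet F ↔ ∀ s ∈ F.cones, ∃ i : Ray F, i.gen ∉ s ∧ z i = 0 := by
  have hmonomial (s : Finset N) :
      MvPolynomial.eval z (zHat F s) = 0 ↔ ∃ i : Ray F, i.gen ∉ s ∧ z i = 0 := by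
    simp [zHat, Finset.prod_eq_zero_iff]
  constructor
  · intro h s hs
    exact (hmonomial s).1 (h _ (Ideal.subset_span ⟨s, hs, rfl⟩))
  · intro h b hb
    have hle : irrelevantIdeal F ≤ RingHom.ker (MvPolynomial.eval z) := by
      rw [irrelevantIdeal, Ideal.span_le]
      rintro _ ⟨s, hs, rfl⟩
      exact (hmonomial s).2 (h s hs)
    exact hle hb

lemma mem_stableSet_iff {z : Ray F → ℂ} :
    z ∈ stableSet F ↔ ∃ s ∈ F.cones, ∀ i : Ray F, i.gen ∉ s → z i ≠ 0 := by
  rw [stableSet, Set.mem_compl_iff, mem_exceptionalSet_iff]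
  push Not
  rfl

lemma toricMk_eq_iff {z w : stableSet F} :
    toricMk F z = toricMk F w ↔ ∃ c ∈ groupD F, w.1 = c • z.1 := by
  refine (Quotient.eq (r := orbitSetoid F)).trans ?_
  exact ⟨fun ⟨c, hc, h⟩ => ⟨c, hc, funext h⟩, fun ⟨c, hc, h⟩ => ⟨c, hc, congrFun h⟩⟩

lemma toricMk_surjective : Function.Surjective (toricMk F) := Quotient.exists_rep

lemma continuous_toricMk : Continuous (toricMk F) := continuous_quotient_mk'

variable (F) in
/-- The Lie algebra of `𝐃(Σ)`, inside the Lie algebra `ℂⁿ` of the torus. -/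
def lieD : Submodule ℂ (Ray F → ℂ) where
  carrier := {L | ∀ m : Module.Dual ℤ N, ∑ i, (m i.gen : ℂ) * L i = 0}
  zero_mem' := by simp
  add_mem' hL hL' m := by simp only [Pi.add_apply, mul_add, Finset.sum_add_distrib, hL m, hL' m,
    add_zero]
  smul_mem' a L hL m := by
    simp only [Pi.smul_apply, smul_eq_mul, mul_left_comm _ a, ← Finset.mul_sum, hL m, mul_zero]

/-- The exponential map of the torus `(ℂ*)ⁿ`. -/
def expTorus (L : Ray F → ℂ) (i : Ray F) : ℂˣ :=
  Units.mk0 (Complex.exp (L i)) (Complex.exp_ne_zero _)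

@[simp] lemma expTorus_zero : expTorus (0 : Ray F → ℂ) = 1 :=
  funext fun _ => Units.ext Complex.exp_zero

@[simp] lemma coe_expTorus (L : Ray F → ℂ) (i : Ray F) :
    (expTorus L i : ℂ) = Complex.exp (L i) := rfl

lemma expTorus_mem_groupD {L : Ray F → ℂ} (hL : L ∈ lieD F) : expTorus L ∈ groupD F := by
  refine mem_groupD.2 fun m => Units.ext ?_
  simp only [Units.coe_prod, Units.val_zpow_eq_zpow_val, coe_expTorus, ← Complex.exp_int_mul,
    ← Complex.exp_sum]
  rw [hL m, Complex.exp_zero, Units.val_one]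

lemma fderiv_lieD_eq_zero {E : Type*} [NormedAddCommGroup E] [NormedSpace ℂ E]
    {g : (Ray F → ℂ) → E} {z L : Ray F → ℂ} (hg : DifferentiableAt ℂ g z)
    (h0 : ∀ᶠ w in 𝓝 z, w ∈ (fun c : Ray F → ℂˣ => c • z) '' groupD F → g w = 0)
    (hL : L ∈ lieD F) : fderiv ℂ g z (L * z) = 0 := by
  let γ (s : ℂ) : Ray F → ℂ := expTorus (s • L) • z
  have hγ0 : γ 0 = z := by simp [γ]
  have hγ : HasDerivAt γ (L * z) 0 := by
    refine hasDerivAt_pi.2 fun i => ?_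
    have hlin : HasDerivAt (fun s : ℂ => s * L i) (L i) 0 := by
      simpa using (hasDerivAt_id (0 : ℂ)).mul_const (L i)
    exact (hlin.cexp.mul_const (z i)).congr_deriv (by simp)
  have hderiv : HasDerivAt (g ∘ γ) (fderiv ℂ g z (L * z)) 0 :=
    HasFDerivAt.comp_hasDerivAt 0 (hγ0.symm ▸ hg.hasFDerivAt) hγ
  have hzero : g ∘ γ =ᶠ[𝓝 0] fun _ => 0 := by
    have htends := hγ.continuousAt.tendsto
    rw [hγ0] at htends
    exact (htends.eventually h0).mono fun s hs =>
      hs ⟨_, expTorus_mem_groupD (Submodule.smul_mem _ s hL), rfl⟩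
  exact hderiv.unique ((hasDerivAt_const (0 : ℂ) (0 : E)).congr_of_eventuallyEq hzero)

lemma weight_varDegree (m : Ray F →₀ ℕ) : Finsupp.weight (varDegree F) m =
    Submodule.Quotient.mk (fun i => (m i : ℤ)) := by
  classical
  have hm : (fun i => (m i : ℤ)) = ∑ i, m i • (Pi.single i 1 : Ray F → ℤ) := by
    ext j
    simp [Finset.sum_apply, Pi.single_apply]
  rw [Finsupp.weight_apply, Finsupp.sum_fintype _ _ (by simp), hm, ← Submodule.mkQ_apply, map_sum]
  refine Finset.sum_congr rfl fun i _ => ?_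
  rw [map_nsmul, Submodule.mkQ_apply, varDegree]

lemma prod_pow_eq_of_weight_eq {c : Ray F → ℂˣ} (hc : c ∈ groupD F) {m n : Ray F →₀ ℕ}
    (h : Finsupp.weight (varDegree F) m = Finsupp.weight (varDegree F) n) :
    ∏ i, c i ^ m i = ∏ i, c i ^ n i := by
  rw [weight_varDegree, weight_varDegree, Submodule.Quotient.eq] at h
  obtain ⟨μ, hμ⟩ := h
  have hquot (i) : c i ^ μ i.gen = c i ^ m i / c i ^ n i := by
    rw [show μ i.gen = m i - n i from congrFun hμ i]
    simp [zpow_sub, div_eq_mul_inv]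
  have hprod := mem_groupD.1 hc μ
  simp only [hquot, Finset.prod_div_distrib] at hprod
  exact div_eq_one.1 hprod

variable {f : MvPolynomial (Ray F) ℂ} {β : ClassGp F}

lemma IsDHomogeneous.exists_eval_smul_eq (hf : IsDHomogeneous F f β) {c : Ray F → ℂˣ}
    (hc : c ∈ groupD F) :
    ∃ χ : ℂˣ, ∀ z, MvPolynomial.eval (c • z) f = χ * MvPolynomial.eval z f := by
  obtain rfl | h0 := eq_or_ne f 0
  · exact ⟨1, by simp⟩
  obtain ⟨n, hn⟩ := MvPolynomial.support_nonempty.2 h0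
  refine ⟨∏ i, c i ^ n i, fun z => ?_⟩
  rw [MvPolynomial.eval_eq', MvPolynomial.eval_eq', Finset.mul_sum]
  refine Finset.sum_congr rfl fun m hm => ?_
  have hmn := prod_pow_eq_of_weight_eq hc
    ((hf (MvPolynomial.mem_support_iff.1 hm)).trans (hf (MvPolynomial.mem_support_iff.1 hn)).symm)
  simp only [units_smul_apply, mul_pow, Finset.prod_mul_distrib, ← hmn, Units.coe_prod,
    Units.val_pow_eq_pow_val]
  ring

lemma IsDHomogeneous.eval_smul_eq_zero_iff (hf : IsDHomogeneous F f β) {c : Ray F → ℂˣ}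
    (hc : c ∈ groupD F) (z : Ray F → ℂ) :
    MvPolynomial.eval (c • z) f = 0 ↔ MvPolynomial.eval z f = 0 := by
  obtain ⟨χ, hχ⟩ := hf.exists_eval_smul_eq hc
  rw [hχ, mul_eq_zero, or_iff_right χ.ne_zero]

lemma toricMk_mem_hypersurface_iff (hf : IsDHomogeneous F f β) {z : stableSet F} :
    toricMk F z ∈ hypersurface F f ↔ MvPolynomial.eval z.1 f = 0 := by
  constructor
  · rintro ⟨w, hw, hwz⟩
    obtain ⟨c, hc, hzc⟩ := toricMk_eq_iff.1 hwz
    rwa [hzc, hf.eval_smul_eq_zero_iff hc]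
  · exact fun h => ⟨z, h, rfl⟩

end Torus

section FullCones

variable {N : Type*} [AddCommGroup N]

/-- A cone of full dimension `d` of the fan, with an enumeration of its rays and the coordinates
of lattice vectors with respect to its generators, multiplied by a common denominator `k`. -/
structure FullCone (F : Fan N) (d : ℕ) where
  cone : Finset N
  cone_mem : cone ∈ F.cones
  idx : Fin d → Ray F
  idx_injective : Function.Injective idx
  gen_mem_cone_iff : ∀ i : Ray F, i.gen ∈ cone ↔ i ∈ Set.range idx
  k : ℕ
  k_ne_zero : k ≠ 0
  coord : Fin d → Module.Dual ℤ N
  smul_eq_sum : ∀ v, (k : ℤ) • v = ∑ a, coord a v • (idx a).gen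
  coord_self : ∀ a, coord a (idx a).gen = k
  coord_of_ne : Pairwise fun a b => coord a (idx b).gen = 0

lemma Fan.exists_fullCone_eq [Module.Free ℤ N] [Module.Finite ℤ N] (F : Fan N) {d : ℕ}
    (hd : Module.finrank ℤ N = d) {s : Finset N} (hs : s ∈ F.cones) (hcard : s.card = d) :
    ∃ σ : FullCone F d, σ.cone = s := by
  obtain ⟨k, κ, hk, hsum, hself, hne⟩ := (F.generators s hs).exists_coords (hcard.trans hd.symm)
  let e : Fin d ≃ s := (s.equivFinOfCardEq hcard).symm
  let idx (a : Fin d) : Ray F := ⟨e a, F.face_mem s hs _ (by simp)⟩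
  refine ⟨⟨s, hs, idx, ?_, ?_, k, hk, fun a => κ (e a), ?_, ?_, ?_⟩, rfl⟩
  · exact fun a b hab => e.injective (Subtype.ext (congrArg Ray.gen hab))
  · refine fun i => ⟨fun hi => ⟨e.symm ⟨i.gen, hi⟩, Subtype.ext ?_⟩, ?_⟩
    · simp [idx, Ray.gen]
    · rintro ⟨a, rfl⟩
      exact (e a).2
  · exact fun v => (hsum v).trans (e.sum_comp fun x : s => κ x v • (x : N)).symm
  · exact fun a => hself (e a)
  · exact fun a b hab => hne (e.injective.ne hab)

end FullCones

namespace FullCone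

variable {N : Type*} [AddCommGroup N] {F : Fan N} {d : ℕ} (σ : FullCone F d)

section Slice

/-- The slice `{zᵢ = 1, eᵢ ∉ σ}`, parametrized by its other coordinates. -/
def slice (v : Fin d → ℂ) : Ray F → ℂ := Function.extend σ.idx v 1

/-- The directions tangent to the slice. -/
def sliceDir : (Fin d → ℂ) →L[ℂ] (Ray F → ℂ) :=
  LinearMap.toContinuousLinearMap (Function.ExtendByZero.linearMap ℂ σ.idx)

@[simp] lemma slice_idx (v : Fin d → ℂ) (a : Fin d) : σ.slice v (σ.idx a) = v a :=
  σ.idx_injective.extend_apply _ _ _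

lemma slice_of_notMem (v : Fin d → ℂ) {i : Ray F} (hi : i ∉ Set.range σ.idx) : σ.slice v i = 1 :=
  Function.extend_apply' _ _ _ hi

@[simp] lemma sliceDir_idx (v : Fin d → ℂ) (a : Fin d) : σ.sliceDir v (σ.idx a) = v a :=
  σ.idx_injective.extend_apply _ _ _

lemma sliceDir_of_notMem (v : Fin d → ℂ) {i : Ray F} (hi : i ∉ Set.range σ.idx) :
    σ.sliceDir v i = 0 :=
  Function.extend_apply' _ _ _ hi

lemma eq_slice {z : Ray F → ℂ} (hz : ∀ i, i ∉ Set.range σ.idx → z i = 1) :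
    z = σ.slice (z ∘ σ.idx) := by
  ext i
  by_cases hi : i ∈ Set.range σ.idx
  · obtain ⟨a, rfl⟩ := hi
    simp
  · rw [hz i hi, σ.slice_of_notMem _ hi]

lemma eq_sliceDir {w : Ray F → ℂ} (hw : ∀ i, i ∉ Set.range σ.idx → w i = 0) :
    w = σ.sliceDir (w ∘ σ.idx) := by
  ext i
  by_cases hi : i ∈ Set.range σ.idx
  · obtain ⟨a, rfl⟩ := hi
    simp
  · rw [hw i hi, σ.sliceDir_of_notMem _ hi]

lemma slice_eq_add (v : Fin d → ℂ) : σ.slice v = σ.slice 0 + σ.sliceDir v := by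
  ext i
  by_cases hi : i ∈ Set.range σ.idx
  · obtain ⟨a, rfl⟩ := hi
    simp
  · simp [σ.slice_of_notMem _ hi, σ.sliceDir_of_notMem _ hi]

lemma hasFDerivAt_slice (v : Fin d → ℂ) : HasFDerivAt σ.slice σ.sliceDir v := by
  rw [show σ.slice = fun v => σ.slice 0 + σ.sliceDir v from funext σ.slice_eq_add]
  exact σ.sliceDir.hasFDerivAt.const_add _

lemma analyticAt_slice (v : Fin d → ℂ) : AnalyticAt ℂ σ.slice v := by
  rw [show σ.slice = fun v => σ.slice 0 + σ.sliceDir v from funext σ.slice_eq_add]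
  exact analyticAt_const.add (σ.sliceDir.analyticAt v)

lemma continuous_slice : Continuous σ.slice :=
  continuous_iff_continuousAt.2 fun v => (σ.analyticAt_slice v).continuousAt

lemma slice_mem_stableSet (v : Fin d → ℂ) : σ.slice v ∈ stableSet F :=
  mem_stableSet_iff.2 ⟨σ.cone, σ.cone_mem, fun i hi => by
    rw [σ.slice_of_notMem v fun h => hi ((σ.gen_mem_cone_iff i).2 h)]
    exact one_ne_zero⟩

end Slice

section Projection

open Filter

lemma sum_mul_sliceDir (g : Ray F → ℂ) (y : Fin d → ℂ) :
    ∑ i, g i * σ.sliceDir y i = ∑ a, g (σ.idx a) * y a :=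
  (Fintype.sum_of_injective σ.idx σ.idx_injective _ _
    (fun i hi => by rw [σ.sliceDir_of_notMem y hi, mul_zero]) fun a => by simp).symm

/-- The projection of `ℂⁿ` onto the Lie algebra of `𝐃(Σ)` along the directions of the slice. -/
def lieProj (L : Ray F → ℂ) : Ray F → ℂ :=
  L - σ.sliceDir fun a => (∑ j, (σ.coord a j.gen : ℂ) * L j) / σ.k

lemma lieProj_mem_lieD (L : Ray F → ℂ) : σ.lieProj L ∈ lieD F := by
  intro m
  have hk : (σ.k : ℂ) ≠ 0 := Nat.cast_ne_zero.2 σ.k_ne_zero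
  have hm (j : Ray F) :
      (m j.gen : ℂ) = (∑ a, (m (σ.idx a).gen : ℂ) * σ.coord a j.gen) / σ.k := by
    have := congrArg m (σ.smul_eq_sum j.gen)
    simp only [map_smul, map_sum, smul_eq_mul, mul_comm (σ.coord _ _)] at this
    rw [eq_div_iff hk, mul_comm]
    exact_mod_cast this
  simp only [lieProj, Pi.sub_apply, mul_sub, Finset.sum_sub_distrib, sum_mul_sliceDir, sub_eq_zero]
  calc ∑ j, (m j.gen : ℂ) * L j
      = ∑ j, ∑ a, (m (σ.idx a).gen : ℂ) * ((σ.coord a j.gen : ℂ) * L j / σ.k) :=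
        Finset.sum_congr rfl fun j _ => by
          rw [hm, Finset.sum_div, Finset.sum_mul]
          exact Finset.sum_congr rfl fun a _ => by ring
    _ = ∑ a, (m (σ.idx a).gen : ℂ) * ((∑ j, (σ.coord a j.gen : ℂ) * L j) / σ.k) := by
        rw [Finset.sum_comm]
        simp only [Finset.sum_div, Finset.mul_sum]

lemma lieProj_of_notMem (L : Ray F → ℂ) {i : Ray F} (hi : i ∉ Set.range σ.idx) :
    σ.lieProj L i = L i := by
  rw [lieProj, Pi.sub_apply, σ.sliceDir_of_notMem _ hi, sub_zero]

lemma exists_fderiv_sliceDir_eq {E : Type*} [NormedAddCommGroup E] [NormedSpace ℂ E]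
    {g : (Ray F → ℂ) → E} {v : Fin d → ℂ} (hg : DifferentiableAt ℂ g (σ.slice v))
    (h0 : ∀ᶠ z in 𝓝 (σ.slice v),
      z ∈ (fun c : Ray F → ℂˣ => c • σ.slice v) '' groupD F → g z = 0)
    (w : Ray F → ℂ) :
    ∃ y, fderiv ℂ g (σ.slice v) (σ.sliceDir y) = fderiv ℂ g (σ.slice v) w := by
  refine ⟨(w - σ.lieProj w * σ.slice v) ∘ σ.idx, ?_⟩
  rw [← σ.eq_sliceDir fun i hi => ?_, map_sub,
    fderiv_lieD_eq_zero hg h0 (σ.lieProj_mem_lieD w), sub_zero]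
  rw [Pi.sub_apply, Pi.mul_apply, σ.lieProj_of_notMem w hi, σ.slice_of_notMem v hi, mul_one,
    sub_self]

open Classical in
/-- The element of `𝐃(Σ)` that moves `w` to the slice, for the principal branch of the
logarithm. -/
def toSlice (w : Ray F → ℂ) : Ray F → ℂˣ :=
  expTorus (σ.lieProj fun j => if j ∈ Set.range σ.idx then 0 else -Complex.log (w j))

lemma toSlice_mem_groupD (w : Ray F → ℂ) : σ.toSlice w ∈ groupD F :=
  expTorus_mem_groupD (σ.lieProj_mem_lieD _)

lemma coe_toSlice_of_notMem {w : Ray F → ℂ} {i : Ray F} (hi : i ∉ Set.range σ.idx)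
    (hw : w i ≠ 0) : (σ.toSlice w i : ℂ) = (w i)⁻¹ := by
  rw [toSlice, coe_expTorus, σ.lieProj_of_notMem _ hi, if_neg hi, Complex.exp_neg,
    Complex.exp_log hw]

lemma toSlice_slice (v : Fin d → ℂ) : σ.toSlice (σ.slice v) = 1 := by
  classical
  have hlog : (fun j =>
      if j ∈ Set.range σ.idx then (0 : ℂ) else -Complex.log (σ.slice v j)) = 0 := by
    ext j
    split_ifs with hj
    · rfl
    · rw [σ.slice_of_notMem v hj, Complex.log_one, neg_zero, Pi.zero_apply]
  have hproj : σ.lieProj 0 = 0 := by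
    ext i
    simp [lieProj, ← Pi.zero_def]
  rw [toSlice, hlog, hproj, expTorus_zero]

lemma analyticAt_coe_toSlice (v : Fin d → ℂ) (i : Ray F) :
    AnalyticAt ℂ (fun w => (σ.toSlice w i : ℂ)) (σ.slice v) := by
  classical
  have hlog (j : Ray F) : AnalyticAt ℂ
      (fun w : Ray F → ℂ => if j ∈ Set.range σ.idx then 0 else -Complex.log (w j))
      (σ.slice v) := by
    split_ifs with hj
    · exact analyticAt_const
    · refine ((analyticAt_pi_iff.1 analyticAt_id j).clog ?_).neg
      rw [σ.slice_of_notMem v hj]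
      exact Complex.one_mem_slitPlane
  have hsum (a : Fin d) := Finset.analyticAt_fun_sum Finset.univ fun j _ =>
    (analyticAt_const (v := (σ.coord a (Ray.gen j) : ℂ))).mul (hlog j)
  refine ((hlog i).sub ?_).cexp
  exact analyticAt_pi_iff.1 ((σ.sliceDir.analyticAt _).comp
    (analyticAt_pi_iff.2 fun a => (hsum a).div_const)) i

/-- The projection to the slice along the orbits of `𝐃(Σ)`. -/
def proj (w : Ray F → ℂ) : Fin d → ℂ := (σ.toSlice w • w) ∘ σ.idx

@[simp] lemma proj_slice (v : Fin d → ℂ) : σ.proj (σ.slice v) = v := by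
  ext a
  simp [proj, toSlice_slice]

lemma slice_proj {w : Ray F → ℂ} (hw : ∀ i, i ∉ Set.range σ.idx → w i ≠ 0) :
    σ.slice (σ.proj w) = σ.toSlice w • w :=
  (σ.eq_slice fun i hi => by
    rw [units_smul_apply, σ.coe_toSlice_of_notMem hi (hw i hi), inv_mul_cancel₀ (hw i hi)]).symm

lemma exists_eq_smul_slice_proj {w : Ray F → ℂ} (hw : ∀ i, i ∉ Set.range σ.idx → w i ≠ 0) :
    ∃ u ∈ groupD F, w = u • σ.slice (σ.proj w) :=
  ⟨_, inv_mem (σ.toSlice_mem_groupD w), by rw [σ.slice_proj hw, inv_smul_smul]⟩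

lemma analyticAt_proj (v : Fin d → ℂ) : AnalyticAt ℂ σ.proj (σ.slice v) :=
  analyticAt_pi_iff.2 fun a =>
    (σ.analyticAt_coe_toSlice v (σ.idx a)).mul (analyticAt_pi_iff.1 analyticAt_id _)

lemma exists_local_proj {c : Ray F → ℂˣ} (hc : c ∈ groupD F) (v : Fin d → ℂ) :
    ∃ μ : (Ray F → ℂ) → (Fin d → ℂ), AnalyticAt ℂ μ (c • σ.slice v) ∧
      (∀ v', μ (c • σ.slice v') = v') ∧
      ∀ᶠ w in 𝓝 (c • σ.slice v), ∃ u ∈ groupD F, w = u • σ.slice (μ w) := by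
  refine ⟨fun w => σ.proj (c⁻¹ • w), ?_, fun v' => by simp, ?_⟩
  · exact (σ.analyticAt_proj v).comp_of_eq (analyticAt_units_smul _ _) (inv_smul_smul _ _)
  have hne : ∀ᶠ w in 𝓝 (c • σ.slice v), ∀ i, i ∉ Set.range σ.idx → w i ≠ 0 := by
    refine eventually_all.2 fun i => ?_
    by_cases hi : i ∈ Set.range σ.idx
    · simp [hi]
    · have hcont : ContinuousAt (fun w : Ray F → ℂ => w i) (c • σ.slice v) :=
        (continuous_apply i).continuousAt
      refine (hcont.eventually_ne ?_).mono fun w hw _ => hw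
      rw [units_smul_apply, σ.slice_of_notMem v hi, mul_one]
      exact (c i).ne_zero
  filter_upwards [hne] with w hw
  obtain ⟨u, hu, huw⟩ := σ.exists_eq_smul_slice_proj (w := c⁻¹ • w)
    fun i hi => mul_ne_zero (Units.ne_zero _) (hw i hi)
  exact ⟨c * u, mul_mem hc hu, by rw [mul_smul, ← huw, smul_inv_smul]⟩

end Projection

end FullCone

lemma exists_eq_smul_slice {N : Type*} [AddCommGroup N] [Module.Free ℤ N] [Module.Finite ℤ N]
    {F : Fan N} {d : ℕ} (hd : Module.finrank ℤ N = d) {z : Ray F → ℂ} (hz : z ∈ stableSet F) :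
    ∃ (σ : FullCone F d) (c : Ray F → ℂˣ) (v : Fin d → ℂ), c ∈ groupD F ∧ z = c • σ.slice v := by
  obtain ⟨s, hs, hsz⟩ := mem_stableSet_iff.1 hz
  obtain ⟨τ, hτ, hsτ, hcard⟩ := F.exists_full_cone hs
  obtain ⟨σ, rfl⟩ := F.exists_fullCone_eq hd hτ (hcard.trans hd)
  obtain ⟨u, hu, h⟩ := σ.exists_eq_smul_slice_proj (w := z) fun j hj =>
    hsz j fun hjs => hj ((σ.gen_mem_cone_iff j).1 (hsτ hjs))
  exact ⟨σ, u, σ.proj z, hu, h⟩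

section Charts

open Filter
open scoped Matrix

variable {N : Type*} [AddCommGroup N] {F : Fan N} {d : ℕ}

lemma eq_one_of_mem_groupD [Module.Free ℤ N] {c : Ray F → ℂˣ}
    (hc : c ∈ groupD F) {i : Ray F} (hfin : IsOfFinOrder (c i)) (hne : ∀ j ≠ i, c j = 1) :
    c i = 1 := by
  have hpow (m : Module.Dual ℤ N) : c i ^ m i.gen = 1 := by
    have hprod := mem_groupD.1 hc m
    rwa [Finset.prod_eq_single i (fun j _ hj => by rw [hne j hj, one_zpow]) (by simp)] at hprod
  exact orderOf_eq_one_iff.1 <| (F.generators _ i.2).eq_one_of_dvd_dual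
    (Finset.mem_singleton_self _) (orderOf_pos_iff.2 hfin)
    fun m => orderOf_dvd_iff_zpow_eq_one.2 (hpow m)

namespace FullCone

variable (σ : FullCone F d) (t : Fin d → ℂ)

/-- The action of the torus `(ℂ*)ⁿ` on the coordinates of the slice, by diagonal matrices. -/
def diagHom : (Ray F → ℂˣ) →* Matrix.GeneralLinearGroup (Fin d) ℂ where
  toFun u :=
    { val := Matrix.diagonal fun a => (u (σ.idx a) : ℂ)
      inv := Matrix.diagonal fun a => ((u (σ.idx a))⁻¹ : ℂˣ)
      val_inv := by simp [Matrix.diagonal_mul_diagonal]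
      inv_val := by simp [Matrix.diagonal_mul_diagonal] }
  map_one' := by ext1; simp
  map_mul' u v := by ext1; simp [Matrix.diagonal_mul_diagonal]

lemma diagHom_mulVec (u : Ray F → ℂˣ) (v : Fin d → ℂ) :
    (σ.diagHom u).1 *ᵥ v = fun a => (u (σ.idx a) : ℂ) * v a :=
  funext fun a => Matrix.mulVec_diagonal _ v a

lemma smul_sliceDir (u : Ray F → ℂˣ) (v : Fin d → ℂ) :
    u • σ.sliceDir v = σ.sliceDir ((σ.diagHom u).1 *ᵥ v) := by
  rw [σ.eq_sliceDir (w := u • σ.sliceDir v) fun i hi => ?_, diagHom_mulVec]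
  · congr 1
    ext a
    rw [Function.comp_apply, units_smul_apply, sliceDir_idx]
  · rw [units_smul_apply, σ.sliceDir_of_notMem v hi, mul_zero]

lemma slice_add (v : Fin d → ℂ) : σ.slice (t + v) = σ.slice t + σ.sliceDir v := by
  rw [slice_eq_add, map_add, ← add_assoc, ← slice_eq_add]

lemma slice_injective : Function.Injective σ.slice := fun v w h => by
  rw [← σ.proj_slice v, h, proj_slice]

/-- The stabilizer in `𝐃(Σ)` of a point of the slice. -/
def stabD : Subgroup (Ray F → ℂˣ) := groupD F ⊓ MulAction.stabilizer (Ray F → ℂˣ) (σ.slice t)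

/-- The linear group by which the stabilizer of a point acts on the slice through this point. -/
def stab : Subgroup (Matrix.GeneralLinearGroup (Fin d) ℂ) := (σ.stabD t).map σ.diagHom

variable {t} {u : Ray F → ℂˣ}

lemma smul_slice_add (hu : u ∈ σ.stabD t) (v : Fin d → ℂ) :
    u • σ.slice (t + v) = σ.slice (t + (σ.diagHom u).1 *ᵥ v) := by
  rw [slice_add, smul_add, MulAction.mem_stabilizer_iff.1 hu.2, smul_sliceDir, slice_add]

lemma eq_one_of_smul_slice_eq {v w : Fin d → ℂ} (h : u • σ.slice v = σ.slice w) {i : Ray F}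
    (hi : i ∉ Set.range σ.idx) : u i = 1 := by
  have happly := congrFun h i
  rw [units_smul_apply, σ.slice_of_notMem v hi, σ.slice_of_notMem w hi, mul_one] at happly
  exact Units.ext happly

lemma pow_eq_one (hu : u ∈ groupD F) {v w : Fin d → ℂ} (h : u • σ.slice v = σ.slice w)
    (i : Ray F) : u i ^ σ.k = 1 := by
  by_cases hi : i ∈ Set.range σ.idx
  · obtain ⟨a, rfl⟩ := hi
    have hprod := mem_groupD.1 hu (σ.coord a)
    rwa [Finset.prod_eq_single (σ.idx a) (fun j _ hj => ?_) (by simp), σ.coord_self,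
      zpow_natCast] at hprod
    by_cases hjr : j ∈ Set.range σ.idx
    · obtain ⟨b, rfl⟩ := hjr
      rw [σ.coord_of_ne fun hab => hj (congrArg σ.idx hab.symm), zpow_zero]
    · rw [σ.eq_one_of_smul_slice_eq h hjr, one_zpow]
  · rw [σ.eq_one_of_smul_slice_eq h hi, one_pow]

lemma finite_setOf_smul_slice_eq :
    {u ∈ groupD F | ∃ v w, u • σ.slice v = σ.slice w}.Finite := by
  have : NeZero σ.k := ⟨σ.k_ne_zero⟩
  have : Finite (rootsOfUnity σ.k ℂ) := inferInstance
  have hroots : {x : ℂˣ | x ^ σ.k = 1}.Finite :=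
    Set.toFinite (rootsOfUnity σ.k ℂ : Set ℂˣ)
  refine (Set.Finite.pi fun _ : Ray F => hroots).subset ?_
  rintro u ⟨hu, v, w, h⟩ i -
  exact σ.pow_eq_one hu h i

lemma stab_pow {g : Matrix.GeneralLinearGroup (Fin d) ℂ} (hg : g ∈ σ.stab t) (v : Fin d → ℂ) :
    (g.1 *ᵥ v) ^ σ.k = v ^ σ.k := by
  obtain ⟨u, hu, rfl⟩ := hg
  ext a
  rw [diagHom_mulVec, Pi.pow_apply, mul_pow, ← Units.val_pow_eq_pow_val, σ.pow_eq_one hu.1 hu.2,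
    Units.val_one, one_mul, Pi.pow_apply]

open Classical in
lemma finrank_eigenspace_diagHom (u : Ray F → ℂˣ) :
    Module.finrank ℂ (Module.End.eigenspace (Matrix.toLin' (σ.diagHom u).1) 1) +
      Fintype.card {a // (u (σ.idx a) : ℂ) - 1 ≠ 0} = d := by
  have hker : Module.End.eigenspace (Matrix.toLin' (σ.diagHom u).1) 1 =
      LinearMap.ker (Matrix.diagonal fun a => (u (σ.idx a) : ℂ) - 1).mulVecLin := by
    ext v
    rw [Module.End.mem_eigenspace_iff, LinearMap.mem_ker, Matrix.toLin'_apply, diagHom_mulVec,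
      one_smul, Matrix.mulVecLin_apply, funext_iff, funext_iff]
    simp only [Matrix.mulVec_diagonal, sub_mul, one_mul, sub_eq_zero, Pi.zero_apply]
  have hrank := LinearMap.finrank_range_add_finrank_ker
    (Matrix.diagonal fun a => (u (σ.idx a) : ℂ) - 1).mulVecLin
  rwa [← hker, Module.finrank_fin_fun, ← Matrix.rank, Matrix.rank_diagonal, add_comm] at hrank

lemma isFiniteSmall_stab [Module.Free ℤ N] (t : Fin d → ℂ) :
    IsFiniteSmall (σ.stab t) := by
  classical
  constructor
  · have hfin : ((σ.stabD t : Subgroup (Ray F → ℂˣ)) : Set (Ray F → ℂˣ)).Finite :=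
      σ.finite_setOf_smul_slice_eq.subset fun u hu => ⟨hu.1, t, t, hu.2⟩
    exact (hfin.image σ.diagHom).to_subtype
  rintro g ⟨u, ⟨hu, hut⟩, rfl⟩ hsum
  obtain ⟨⟨a, ha⟩, hua⟩ := Fintype.card_eq_one_iff.1
    (Nat.add_left_cancel ((σ.finrank_eigenspace_diagHom u).trans hsum.symm))
  have hne (i : Ray F) (hi : i ≠ σ.idx a) : u i = 1 := by
    by_cases hir : i ∈ Set.range σ.idx
    · obtain ⟨b, rfl⟩ := hir
      by_contra hb
      exact hi (congrArg σ.idx (congrArg Subtype.val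
        (hua ⟨b, fun h => hb (Units.ext (sub_eq_zero.1 h))⟩)))
    · exact σ.eq_one_of_smul_slice_eq hut hir
  have hfin : IsOfFinOrder (u (σ.idx a)) := isOfFinOrder_iff_pow_eq_one.2
    ⟨σ.k, Nat.pos_of_ne_zero σ.k_ne_zero, σ.pow_eq_one hu hut _⟩
  exact ha (by rw [eq_one_of_mem_groupD hu hfin hne, Units.val_one, sub_self])

variable (t)

/-- The map from the slice, centred at its point `t`, to the toric variety. -/
def toToric (v : Fin d → ℂ) : ToricVariety F := toricMk F ⟨σ.slice (t + v), σ.slice_mem_stableSet _⟩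

lemma continuous_slice_add :
    Continuous fun v => (⟨σ.slice (t + v), σ.slice_mem_stableSet _⟩ : stableSet F) :=
  (σ.continuous_slice.comp (continuous_const.add continuous_id)).subtype_mk _

lemma analyticAt_slice_add (v : Fin d → ℂ) : AnalyticAt ℂ (fun v => σ.slice (t + v)) v :=
  (σ.analyticAt_slice (t + v)).comp_of_eq (analyticAt_const.add analyticAt_id) rfl

variable {t}

lemma toricMk_eq_toToric_iff {v : Fin d → ℂ} {z : stableSet F} :
    toricMk F z = σ.toToric t v ↔ ∃ c ∈ groupD F, z.1 = c • σ.slice (t + v) := by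
  rw [eq_comm, toToric, toricMk_eq_iff]

lemma toToric_mem_hypersurface_iff {f : MvPolynomial (Ray F) ℂ} {β : ClassGp F}
    (hf : IsDHomogeneous F f β) {v : Fin d → ℂ} :
    σ.toToric t v ∈ hypersurface F f ↔ MvPolynomial.eval (σ.slice (t + v)) f = 0 :=
  toricMk_mem_hypersurface_iff hf

lemma exists_analyticAt_toToric_eq {v : Fin d → ℂ} {z : stableSet F}
    (hz : toricMk F z = σ.toToric t v) :
    ∃ μ : (Ray F → ℂ) → (Fin d → ℂ), AnalyticAt ℂ μ z ∧ μ z = v ∧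
      ∀ᶠ w : stableSet F in 𝓝 z, toricMk F w = σ.toToric t (μ w) := by
  obtain ⟨c, hc, hzc⟩ := σ.toricMk_eq_toToric_iff.1 hz
  obtain ⟨μ, hμ, hμv, hμu⟩ := σ.exists_local_proj hc (t + v)
  rw [← hzc] at hμ hμu
  refine ⟨fun w => μ w - t, hμ.sub analyticAt_const, ?_, ?_⟩
  · simp only [hzc, hμv, add_sub_cancel_left]
  filter_upwards [continuous_subtype_val.continuousAt.eventually hμu] with w ⟨u, hu, hwu⟩
  exact σ.toricMk_eq_toToric_iff.2 ⟨u, hu, by rwa [add_sub_cancel]⟩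

variable (t)

lemma continuous_toToric : Continuous (σ.toToric t) :=
  continuous_toricMk.comp (σ.continuous_slice_add t)

lemma isOpenMap_toToric : IsOpenMap (σ.toToric t) := by
  intro W hW
  change IsOpen (toricMk F ⁻¹' (σ.toToric t '' W))
  rw [isOpen_iff_mem_nhds]
  rintro z ⟨v, hv, hvz⟩
  obtain ⟨μ, hμ, rfl, hμz⟩ := σ.exists_analyticAt_toToric_eq hvz.symm
  have hμW : ∀ᶠ w : stableSet F in 𝓝 z, μ w ∈ W :=
    continuous_subtype_val.continuousAt.eventually (hμ.continuousAt.eventually (hW.mem_nhds hv))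
  filter_upwards [hμW, hμz] with w hw hwz
  exact ⟨μ w, hw, hwz.symm⟩

/-- The map `ℂᵈ / stab t → 𝐏` induced by `toToric`: the local model of `𝐏` at the image of `t`. -/
def chart : LinearQuotient (σ.stab t) → ToricVariety F :=
  Quotient.lift (s := linearSetoid (σ.stab t)) (σ.toToric t) <| by
    rintro v _ ⟨_, ⟨u, hu, rfl⟩, rfl⟩
    exact (σ.toricMk_eq_toToric_iff.2 ⟨u, hu.1, (σ.smul_slice_add hu v).symm⟩).symm

@[simp] lemma chart_linearMk (v : Fin d → ℂ) :
    σ.chart t (linearMk (σ.stab t) v) = σ.toToric t v := rfl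

lemma continuous_chart : Continuous (σ.chart t) := (σ.continuous_toToric t).quotient_lift _

lemma isOpenMap_chart : IsOpenMap (σ.chart t) := by
  intro V hV
  rw [← Set.image_preimage_eq V linearMk_surjective, Set.image_image]
  exact σ.isOpenMap_toToric t _ (hV.preimage continuous_linearMk)

lemma eventually_smul_slice_eq : ∀ᶠ q : (Fin d → ℂ) × (Fin d → ℂ) in 𝓝 0, ∀ u ∈ groupD F,
    u • σ.slice (t + q.1) = σ.slice (t + q.2) → u ∈ σ.stabD t := by
  have hall := (eventually_all_finite σ.finite_setOf_smul_slice_eq (l := 𝓝 0)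
    (p := fun u (q : (Fin d → ℂ) × (Fin d → ℂ)) =>
      u • σ.slice (t + q.1) = σ.slice (t + q.2) → u ∈ σ.stabD t)).2 ?_
  · exact hall.mono fun q hq u hu h => hq u ⟨hu, _, _, h⟩ h
  rintro u ⟨hu, -⟩
  by_cases hut : u • σ.slice t = σ.slice t
  · exact Eventually.of_forall fun _ _ => ⟨hu, hut⟩
  · have hl : ContinuousAt (fun q : (Fin d → ℂ) × (Fin d → ℂ) => u • σ.slice (t + q.1)) 0 :=
      ContinuousAt.comp (g := fun v => u • σ.slice (t + v)) ((analyticAt_units_smul u _).comp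
        (σ.analyticAt_slice_add t 0)).continuousAt continuousAt_fst
    have hr : ContinuousAt (fun q : (Fin d → ℂ) × (Fin d → ℂ) => σ.slice (t + q.2)) 0 :=
      ContinuousAt.comp (g := fun v => σ.slice (t + v))
        (σ.analyticAt_slice_add t 0).continuousAt continuousAt_snd
    refine (hl.ne_iff_eventually_ne hr |>.1 ?_).mono fun q hq h => absurd h hq
    simpa using hut

lemma exists_injOn_chart : ∃ U, IsOpen U ∧ linearMk (σ.stab t) 0 ∈ U ∧ Set.InjOn (σ.chart t) U := by
  have hev := σ.eventually_smul_slice_eq t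
  rw [Prod.zero_eq_mk, nhds_prod_eq] at hev
  obtain ⟨W, hW, hWu⟩ := (eventually_prod_self_iff (r := fun v w => ∀ u ∈ groupD F,
      u • σ.slice (t + v) = σ.slice (t + w) → u ∈ σ.stabD t)).1 hev
  obtain ⟨W', hWW', hW'o, hW'0⟩ := mem_nhds_iff.1 hW
  refine ⟨_, isOpenMap_linearMk W' hW'o, ⟨0, hW'0, rfl⟩, ?_⟩
  rintro _ ⟨v, hv, rfl⟩ _ ⟨w, hw, rfl⟩ hvw
  obtain ⟨u, hu, huv⟩ := σ.toricMk_eq_toToric_iff.1 hvw.symm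
  have hut := hWu v (hWW' hv) w (hWW' hw) u hu huv.symm
  rw [σ.smul_slice_add hut] at huv
  exact linearMk_eq_iff.2 ⟨σ.diagHom u, ⟨u, hut, rfl⟩, add_left_cancel (σ.slice_injective huv)⟩

lemma holAt_toToric_iff (h : ToricVariety F → ℂ) (v : Fin d → ℂ) :
    ToricVariety.HolAt F h (σ.toToric t v) ↔
      LinearQuotient.HolAt (σ.stab t) (fun y => h (σ.chart t y)) (linearMk (σ.stab t) v) := by
  constructor
  · intro hh v' hv'
    obtain ⟨H, hH, hHh⟩ := hh ⟨σ.slice (t + v'), σ.slice_mem_stableSet _⟩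
      (congrArg (σ.chart t) hv')
    exact (AnalyticAt.comp (g := H) (f := fun v => σ.slice (t + v)) hH
      (σ.analyticAt_slice_add t v')).congr
      ((σ.continuous_slice_add t).continuousAt.eventually hHh)
  · intro hh z hz
    obtain ⟨μ, hμ, rfl, hμz⟩ := σ.exists_analyticAt_toToric_eq hz
    exact ⟨fun w => h (σ.toToric t (μ w)),
      AnalyticAt.comp (g := fun v => h (σ.toToric t v)) (hh _ rfl) hμ,
      hμz.mono fun w hw => congrArg h hw.symm⟩

lemma exists_isGermIso :
    ∃ φ : OpenPartialHomeomorph (LinearQuotient (σ.stab t)) (ToricVariety F),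
      IsGermIso F (σ.stab t) (σ.toToric t 0) φ ∧ ⇑φ = σ.chart t := by
  obtain ⟨U, hU, h0, hinj⟩ := σ.exists_injOn_chart t
  have : Nonempty (LinearQuotient (σ.stab t)) := ⟨linearMk _ 0⟩
  refine ⟨OpenPartialHomeomorph.ofContinuousOpen (hinj.toPartialEquiv _ U)
    (σ.continuous_chart t).continuousOn (σ.isOpenMap_chart t) hU, ⟨h0, rfl, fun x _ h => ?_⟩, rfl⟩
  obtain ⟨v, rfl⟩ := linearMk_surjective x
  exact σ.holAt_toToric_iff t h v

end FullCone

lemma isVManifold [Module.Free ℤ N] [Module.Finite ℤ N] (hd : Module.finrank ℤ N = d) :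
    IsVManifold F d := by
  intro p
  obtain ⟨z, rfl⟩ := toricMk_surjective p
  obtain ⟨σ, c, t, hc, hz⟩ := exists_eq_smul_slice hd z.2
  obtain ⟨φ, hφ, -⟩ := σ.exists_isGermIso t
  have hzt : toricMk F z = σ.toToric t 0 := σ.toricMk_eq_toToric_iff.2 ⟨c, hc, by rwa [add_zero]⟩
  exact ⟨σ.stab t, σ.isFiniteSmall_stab t, φ, hzt ▸ hφ⟩

end Charts

section QuasiSmooth

open Filter

lemma surjective_fderiv_of_rightInverse {𝕜 E E' : Type*} [NontriviallyNormedField 𝕜]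
    [NormedAddCommGroup E] [NormedSpace 𝕜 E] [NormedAddCommGroup E'] [NormedSpace 𝕜 E']
    {μ : E → E'} {γ : E' → E} {v : E'} (hμ : DifferentiableAt 𝕜 μ (γ v))
    (hγ : DifferentiableAt 𝕜 γ v) (hμγ : ∀ᶠ y in 𝓝 v, μ (γ y) = y) :
    Function.Surjective (fderiv 𝕜 μ (γ v)) := by
  have hcomp : (fderiv 𝕜 μ (γ v)).comp (fderiv 𝕜 γ v) = ContinuousLinearMap.id 𝕜 E' := by
    rw [← fderiv_comp v hμ hγ, ← fderiv_id]
    exact EventuallyEq.fderiv_eq hμγ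
  exact fun y => ⟨fderiv 𝕜 γ v y, DFunLike.congr_fun hcomp y⟩

lemma isSmoothAt_add_left_iff {ι : Type*} [Fintype ι] {T : Set (ι → ℂ)} {t v : ι → ℂ} :
    IsSmoothAt {v | t + v ∈ T} v ↔ IsSmoothAt T (t + v) := by
  have han (s x : ι → ℂ) : AnalyticAt ℂ (fun v => s + v) x := analyticAt_const.add analyticAt_id
  have hsurj (s x : ι → ℂ) : Function.Surjective (fderiv ℂ (fun v => s + v) x) := by
    rw [fderiv_const_add, fderiv_fun_id]
    exact Function.surjective_id
  exact ⟨fun h => .of_submersion (han (-t) _) (hsurj _ _) (by simpa using h) (by simp),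
    fun h => .of_submersion (han t v) (hsurj _ _) h (by simp)⟩

variable {N : Type*} [AddCommGroup N] {F : Fan N} {d : ℕ}
variable {f : MvPolynomial (Ray F) ℂ} {β : ClassGp F}

lemma FullCone.isSmoothAt_smul_slice (σ : FullCone F d) (hf : IsDHomogeneous F f β)
    {c : Ray F → ℂˣ} (hc : c ∈ groupD F) {v : Fin d → ℂ}
    (h : IsSmoothAt (σ.slice ⁻¹' zeroSet F f) v) : IsSmoothAt (zeroSet F f) (c • σ.slice v) := by
  obtain ⟨μ, hμ, hμv, hμu⟩ := σ.exists_local_proj hc v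
  have hslice : AnalyticAt ℂ (fun v => c • σ.slice v) v :=
    (analyticAt_units_smul c _).comp (σ.analyticAt_slice v)
  refine .of_submersion hμ (surjective_fderiv_of_rightInverse hμ.differentiableAt
    hslice.differentiableAt (Eventually.of_forall hμv)) (by rwa [hμv]) ?_
  filter_upwards [hμu] with w ⟨u, hu, hwu⟩
  change MvPolynomial.eval w f = 0 ↔ MvPolynomial.eval (σ.slice (μ w)) f = 0
  conv_lhs => rw [hwu]
  exact hf.eval_smul_eq_zero_iff hu _

lemma FullCone.isSmoothAt_slice_preimage (σ : FullCone F d) (hf : IsDHomogeneous F f β)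
    {v : Fin d → ℂ} (hv : σ.slice v ∈ zeroSet F f) (h : IsSmoothAt (zeroSet F f) (σ.slice v)) :
    IsSmoothAt (σ.slice ⁻¹' zeroSet F f) v := by
  obtain ⟨r, H, hH, hHs, hHf⟩ := h
  have hslice := σ.analyticAt_slice v
  refine ⟨r, H ∘ σ.slice, hH.comp hslice, ?_, hslice.continuousAt.eventually hHf⟩
  rw [(hH.differentiableAt.hasFDerivAt.comp v (σ.hasFDerivAt_slice v)).fderiv]
  have hvanish : ∀ᶠ z in 𝓝 (σ.slice v),
      z ∈ (fun c : Ray F → ℂˣ => c • σ.slice v) '' groupD F → H z = 0 := by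
    filter_upwards [hHf] with z hz
    rintro ⟨u, hu, rfl⟩
    exact hz.1 ((hf.eval_smul_eq_zero_iff hu _).2 hv)
  intro x
  obtain ⟨w, rfl⟩ := hHs x
  exact σ.exists_fderiv_sliceDir_eq hH.differentiableAt hvanish w

lemma IsGermIso.isHolIso {G G' : Subgroup (Matrix.GeneralLinearGroup (Fin d) ℂ)}
    {p p' : ToricVariety F} {φ : OpenPartialHomeomorph (LinearQuotient G) (ToricVariety F)}
    {φ' : OpenPartialHomeomorph (LinearQuotient G') (ToricVariety F)} (hφ : IsGermIso F G p φ)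
    (hφ' : IsGermIso F G' p' φ') : IsHolIso (φ.trans φ'.symm) := by
  intro x hx q
  obtain ⟨hx, hx'⟩ : x ∈ φ.source ∧ φ x ∈ φ'.target := by simpa using hx
  have hiff := hφ'.2.2 (φ'.symm (φ x)) (φ'.map_target hx') (fun p => q (φ'.symm p))
  rw [φ'.right_inv hx'] at hiff
  have hq : (fun y => q (φ'.symm (φ' y))) =ᶠ[𝓝 (φ'.symm (φ x))] q := by
    filter_upwards [φ'.open_source.mem_nhds (φ'.map_target hx')] with y hy
    rw [φ'.left_inv hy]
  exact Iff.trans ⟨fun h => h.congr hq, fun h => h.congr hq.symm⟩ (hiff.symm.trans (hφ.2.2 x hx _))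

lemma IsGermIso.exists_lift_toToric [Module.Free ℤ N] {σ : FullCone F d} {t : Fin d → ℂ}
    {G : Subgroup (Matrix.GeneralLinearGroup (Fin d) ℂ)} (hG : IsFiniteSmall G)
    {φ : OpenPartialHomeomorph (LinearQuotient G) (ToricVariety F)}
    (hφ : IsGermIso F G (σ.toToric t 0) φ) :
    ∃ Ψ : (Fin d → ℂ) → (Fin d → ℂ), AnalyticAt ℂ Ψ 0 ∧ jac Ψ 0 ≠ 0 ∧
      ∀ᶠ x in 𝓝 0, linearMk G x ∈ φ.source ∧ φ (linearMk G x) = σ.toToric t (Ψ x) := by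
  obtain ⟨φ', hφ', hφc⟩ := σ.exists_isGermIso t
  have h0 : linearMk G 0 ∈ (φ.trans φ'.symm).source := by
    simpa [hφ.1, hφ.2.1, hφ'.2.1] using φ'.map_source hφ'.1
  obtain ⟨Ψ, hΨ, hΨj, hΨφ⟩ := (hφ.isHolIso hφ').exists_biholomorphic_lift hG
    (σ.isFiniteSmall_stab t) h0 σ.k_ne_zero fun g hg v => σ.stab_pow hg v
  refine ⟨Ψ, hΨ, hΨj, ?_⟩
  filter_upwards [hΨφ, IsHolIso.eventually_mem_source h0] with x hx hxs
  obtain ⟨hxs, hxt⟩ : linearMk G x ∈ φ.source ∧ φ (linearMk G x) ∈ φ'.target := by simpa using hxs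
  rw [← σ.chart_linearMk, ← hφc, ← hx]
  exact ⟨hxs, (φ'.right_inv hxt).symm⟩

variable [Module.Free ℤ N] [Module.Finite ℤ N]

theorem IsQuasiSmooth.isVSubmanifold (hd : Module.finrank ℤ N = d) (hf : IsDHomogeneous F f β)
    (hq : IsQuasiSmooth F f) : IsVSubmanifold F d (hypersurface F f) := by
  refine ⟨isVManifold hd, ?_⟩
  rintro _ ⟨z, hz, rfl⟩
  obtain ⟨σ, c, t, hc, hzc⟩ := exists_eq_smul_slice hd z.2
  obtain ⟨φ, hφ, hφc⟩ := σ.exists_isGermIso t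
  have hzt : toricMk F z = σ.toToric t 0 := σ.toricMk_eq_toToric_iff.2 ⟨c, hc, by rwa [add_zero]⟩
  refine ⟨σ.stab t, σ.isFiniteSmall_stab t, φ, hzt ▸ hφ, ?_⟩
  have ht : σ.slice t ∈ zeroSet F f := (hf.eval_smul_eq_zero_iff hc _).1 (hzc ▸ hz)
  have hsmooth : IsSmoothAt {v | t + v ∈ σ.slice ⁻¹' zeroSet F f} 0 := by
    rw [isSmoothAt_add_left_iff, add_zero]
    exact σ.isSmoothAt_slice_preimage hf ht (hq _ ht (σ.slice_mem_stableSet t))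
  obtain ⟨r, H, hH, hHs, hHf⟩ := hsmooth
  refine ⟨r, H, hH, hHs, ?_⟩
  filter_upwards [hHf, continuous_linearMk.continuousAt.preimage_mem_nhds
    (φ.open_source.mem_nhds hφ.1)] with v hv hvs
  refine Iff.trans ?_ hv
  refine (and_iff_right hvs).trans ?_
  rw [hφc, σ.chart_linearMk, σ.toToric_mem_hypersurface_iff hf]
  rfl

theorem IsVSubmanifold.isQuasiSmooth (hd : Module.finrank ℤ N = d) (hf : IsDHomogeneous F f β)
    (hX : IsVSubmanifold F d (hypersurface F f)) : IsQuasiSmooth F f := by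
  intro z hz hzs
  obtain ⟨σ, c, t, hc, hzc⟩ := exists_eq_smul_slice hd hzs
  have hzt : toricMk F ⟨z, hzs⟩ = σ.toToric t 0 :=
    σ.toricMk_eq_toToric_iff.2 ⟨c, hc, by rwa [add_zero]⟩
  obtain ⟨G, hG, φ, hφ, hsmooth⟩ := hX.2 _ ⟨⟨z, hzs⟩, hz, hzt⟩
  obtain ⟨Ψ, hΨ, hΨj, hΨφ⟩ := hφ.exists_lift_toToric hG
  have hsmooth' : IsSmoothAt {v | t + v ∈ σ.slice ⁻¹' zeroSet F f} (Ψ 0) := by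
    refine hsmooth.image hΨ hΨj (hΨφ.mono fun x hx => (and_iff_right hx.1).trans ?_)
    rw [hx.2, σ.toToric_mem_hypersurface_iff hf]
    rfl
  obtain ⟨c', hc', rfl⟩ : ∃ c' ∈ groupD F, z = c' • σ.slice (t + Ψ 0) :=
    (σ.toricMk_eq_toToric_iff (z := ⟨z, hzs⟩)).1
      (by rw [hzt, ← hφ.2.1, hΨφ.self_of_nhds.2])
  exact σ.isSmoothAt_smul_slice hf hc' (isSmoothAt_add_left_iff.1 hsmooth')

end QuasiSmooth

section Squarefree

open Polynomial

lemma squarefree_map_equiv {M M' : Type*} [Monoid M] [Monoid M'] (e : M ≃* M') {x : M}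
    (hx : Squarefree x) : Squarefree (e x) := fun y hy => by
  simpa using (hx (e.symm y) (by simpa using map_dvd e.symm hy)).map e

section FractionRing

variable {R K : Type*} [CommRing R] [IsDomain R]

lemma exists_isPrimitive_associated_map [NormalizedGCDMonoid R] [Field K] [Algebra R K]
    [IsFractionRing R K] {p : K[X]} (hp : p ≠ 0) :
    ∃ q : R[X], q.IsPrimitive ∧ Associated (q.map (algebraMap R K)) p := by
  have hinj : Function.Injective (algebraMap R K) := IsFractionRing.injective R K
  obtain ⟨b, hb, hP⟩ := IsLocalization.integerNormalization_spec (nonZeroDivisors R) p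
  set P := IsLocalization.integerNormalization (nonZeroDivisors R) p
  have hP0 : P ≠ 0 := IsFractionRing.integerNormalization_eq_zero_iff.not.2 hp
  have hb0 : algebraMap R K b ≠ 0 := (map_ne_zero_iff _ hinj).2 (nonZeroDivisors.ne_zero hb)
  have hc0 : algebraMap R K P.content ≠ 0 :=
    (map_ne_zero_iff _ hinj).2 (content_eq_zero_iff.not.2 hP0)
  have hcontent : C (algebraMap R K P.content) * P.primPart.map (algebraMap R K) =
      C (algebraMap R K b) * p := by
    rw [← map_C, ← Polynomial.map_mul, ← P.eq_C_content_mul_primPart, hP, ← algebraMap_smul K b p,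
      smul_eq_C_mul]
  refine ⟨P.primPart, P.isPrimitive_primPart, ?_⟩
  exact (associated_unit_mul_left _ _ (isUnit_C.2 hc0.isUnit)).symm.trans
    (hcontent ▸ associated_unit_mul_left p _ (isUnit_C.2 hb0.isUnit))

variable [UniqueFactorizationMonoid R]

lemma squarefree_map_fractionRing [Field K] [Algebra R K] [IsFractionRing R K] {g : R[X]}
    (hg : Squarefree g) : Squarefree (g.map (algebraMap R K)) := by
  let _ : NormalizedGCDMonoid R := Classical.choice inferInstance
  have hg0 : g.map (algebraMap R K) ≠ 0 :=
    (Polynomial.map_ne_zero_iff (IsFractionRing.injective R K)).2 hg.ne_zero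
  intro p hp
  obtain ⟨q, hq, hqp⟩ := exists_isPrimitive_associated_map (R := R)
    (left_ne_zero_of_mul (ne_zero_of_dvd_ne_zero hg0 hp))
  have hqg : q * q ∣ g := (hq.mul hq).dvd_of_fraction_map_dvd_fraction_map (K := K) <| by
    rw [Polynomial.map_mul]
    exact (mul_dvd_mul hqp.dvd hqp.dvd).trans hp
  exact hqp.isUnit ((hg q hqg).map (mapRingHom (algebraMap R K)))

lemma exists_bezout_derivative [CharZero R] {g : R[X]} (hg : Squarefree g) :
    ∃ (a b : R[X]) (D : R), D ≠ 0 ∧ a * g + b * derivative g = C D := by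
  let K := FractionRing R
  have hinj : Function.Injective (algebraMap R K) := IsFractionRing.injective R K
  have : CharZero K := charZero_of_injective_algebraMap hinj
  obtain ⟨a, b, hab⟩ := PerfectField.separable_iff_squarefree.2
    (squarefree_map_fractionRing (K := K) hg)
  obtain ⟨u, hu, ha⟩ := IsLocalization.integerNormalization_spec (nonZeroDivisors R) a
  obtain ⟨v, hv, hb⟩ := IsLocalization.integerNormalization_spec (nonZeroDivisors R) b
  refine ⟨C v * IsLocalization.integerNormalization (nonZeroDivisors R) a,
    C u * IsLocalization.integerNormalization (nonZeroDivisors R) b, u * v,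
    mul_ne_zero (nonZeroDivisors.ne_zero hu) (nonZeroDivisors.ne_zero hv),
    Polynomial.map_injective _ hinj ?_⟩
  rw [Polynomial.derivative_map] at hab
  rw [← algebraMap_smul K, smul_eq_C_mul] at ha hb
  simp only [Polynomial.map_add, Polynomial.map_mul, Polynomial.map_C, ha, hb, map_mul]
  linear_combination (C (algebraMap R K u) * C (algebraMap R K v)) * hab

end FractionRing

open MvPolynomial

variable {σ R : Type*} [CommRing R]

lemma optionEquivLeft_pderiv_none (p : MvPolynomial (Option σ) R) :
    optionEquivLeft R σ (pderiv none p) = derivative (optionEquivLeft R σ p) := by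
  induction p using MvPolynomial.induction_on with
  | C c => simp
  | add p q hp hq => simp only [map_add, hp, hq]
  | mul_X p j hp =>
    rw [pderiv_mul, map_add, map_mul, map_mul, map_mul, hp, Polynomial.derivative_mul]
    cases j with
    | none => simp
    | some j => simp [pderiv_X_of_ne]

lemma optionEquivLeft_rename_some (p : MvPolynomial σ R) :
    optionEquivLeft R σ (rename some p) = Polynomial.C p := by
  induction p using MvPolynomial.induction_on with
  | C c => simp
  | add p q hp hq => simp only [map_add, hp, hq]
  | mul_X p j hp => simp only [map_mul, hp, rename_X, optionEquivLeft_X_some]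

variable [IsDomain R] [UniqueFactorizationMonoid R] [CharZero R]

lemma exists_bezout_pderiv_none {f : MvPolynomial (Option σ) R} (hf : Squarefree f) :
    ∃ (A B : MvPolynomial (Option σ) R) (D : MvPolynomial σ R), D ≠ 0 ∧
      A * f + B * pderiv none f = rename some D := by
  let e := optionEquivLeft R σ
  obtain ⟨a, b, D, hD, hab⟩ := exists_bezout_derivative (squarefree_map_equiv e.toMulEquiv hf)
  refine ⟨e.symm a, e.symm b, D, hD, e.injective ?_⟩
  rw [optionEquivLeft_rename_some, ← hab]
  simp [e, optionEquivLeft_pderiv_none]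

lemma exists_bezout_pderiv {f : MvPolynomial σ R} (hf : Squarefree f) (i : σ) :
    ∃ (A B : MvPolynomial σ R) (D : MvPolynomial {j // j ≠ i} R), D ≠ 0 ∧
      A * f + B * pderiv i f = rename Subtype.val D := by
  classical
  let ε := Equiv.optionSubtypeNe i
  let e := renameEquiv R ε.symm
  obtain ⟨a, b, D, hD, hab⟩ := exists_bezout_pderiv_none (squarefree_map_equiv e.toMulEquiv hf)
  refine ⟨e.symm a, e.symm b, D, hD, e.injective ?_⟩
  have hpderiv : pderiv none (e f) = e (pderiv i f) := by
    simpa [ε, e] using pderiv_rename ε.symm.injective (x := i) (p := f)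
  have hrename : e (rename Subtype.val D) = rename some D := by
    simp only [e, renameEquiv_apply, rename_rename]
    congr 2
    ext j
    simp [ε, Equiv.optionSubtypeNe_symm_of_ne j.2]
  rw [hrename, ← hab]
  simp [hpderiv]

end Squarefree

section SimpleZeros

open Metric Filter

lemma mul_norm_sub_le_of_forall_sphere {q : ℂ → ℂ} {r m : ℝ} (hr : 0 < r) (hm : 0 < m)
    (hq : AnalyticOnNhd ℂ q (closedBall 0 r)) {a : ℂ} (ha : a ∈ closedBall 0 r) (hqa : q a = 0)
    (hda : deriv q a ≠ 0) (huniq : ∀ s ∈ closedBall 0 r, q s = 0 → s = a)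
    (hsphere : ∀ s ∈ sphere (0 : ℂ) r, m ≤ ‖q s‖) {s : ℂ} (hs : s ∈ closedBall 0 r) :
    m / (2 * r) * ‖s - a‖ ≤ ‖q s‖ := by
  have hmul (s : ℂ) : ‖q s‖ = ‖dslope q a s‖ * ‖s - a‖ := by
    rw [← norm_mul, mul_comm, ← smul_eq_mul, sub_smul_dslope, hqa, sub_zero]
  have hdiff : DifferentiableOn ℂ (dslope q a) (closedBall 0 r) :=
    ((Complex.differentiableOn_dslope ((isOpen_analyticAt ℂ q).mem_nhds (hq a ha))).2
      fun z hz => AnalyticAt.differentiableWithinAt hz).mono hq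
  have hne : ∀ s ∈ closedBall (0 : ℂ) r, dslope q a s ≠ 0 := fun s hs h => by
    obtain rfl := huniq s hs (by simpa [h] using hmul s)
    exact hda (by rwa [dslope_same] at h)
  have hle : ∀ s ∈ sphere (0 : ℂ) r, m / (2 * r) ≤ ‖dslope q a s‖ := fun s hs => by
    have hsa : ‖s - a‖ ≤ 2 * r := by
      linarith [norm_sub_le s a, mem_sphere_zero_iff_norm.1 hs, mem_closedBall_zero_iff.1 ha]
    rw [div_le_iff₀ (by positivity)]
    calc m ≤ ‖dslope q a s‖ * ‖s - a‖ := (hsphere s hs).trans_eq (hmul s)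
      _ ≤ ‖dslope q a s‖ * (2 * r) := by gcongr
  rw [hmul]
  gcongr
  exact le_norm_of_forall_sphere hr (by positivity) hdiff hne hle s hs

lemma mul_norm_le_norm_add_norm {q : ℂ → ℂ} {r m : ℝ} (hr : 0 < r) (hm : 0 < m)
    (hq : AnalyticOnNhd ℂ q (closedBall 0 r))
    (huniq : ∀ s ∈ closedBall 0 r, ∀ s' ∈ closedBall 0 r, q s = 0 → q s' = 0 → s = s')
    (hsimple : ∀ s ∈ closedBall 0 r, q s = 0 → deriv q s ≠ 0)
    (hsphere : ∀ s ∈ sphere (0 : ℂ) r, m ≤ ‖q s‖) {s : ℂ} (hs : s ∈ closedBall 0 r) :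
    m / (2 * r) * ‖s‖ ≤ ‖q s‖ + ‖q 0‖ := by
  have h0 : (0 : ℂ) ∈ closedBall 0 r := mem_closedBall_self hr.le
  by_cases hzero : ∃ a ∈ closedBall 0 r, q a = 0
  · obtain ⟨a, ha, hqa⟩ := hzero
    have hbound {s : ℂ} (hs : s ∈ closedBall 0 r) : m / (2 * r) * ‖s - a‖ ≤ ‖q s‖ :=
      mul_norm_sub_le_of_forall_sphere hr hm hq ha hqa (hsimple a ha hqa)
        (fun z hz hqz => huniq z hz a ha hqz hqa) hsphere hs
    calc m / (2 * r) * ‖s‖ ≤ m / (2 * r) * (‖s - a‖ + ‖0 - a‖) := by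
          gcongr
          simpa using norm_add_le (s - a) a
      _ ≤ ‖q s‖ + ‖q 0‖ := by
          rw [mul_add]
          exact add_le_add (hbound hs) (hbound h0)
  · push Not at hzero
    have hq0 : m ≤ ‖q 0‖ := le_norm_of_forall_sphere hr hm
      (fun z hz => (hq z hz).differentiableWithinAt) hzero hsphere 0 h0
    calc m / (2 * r) * ‖s‖ ≤ m / (2 * r) * r := by
          gcongr
          exact mem_closedBall_zero_iff.1 hs
      _ ≤ m := by
          field_simp
          norm_num
      _ ≤ ‖q s‖ + ‖q 0‖ := hq0.trans (le_add_of_nonneg_left (norm_nonneg _))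

lemma le_norm_of_hasDerivAt {q : ℂ → ℂ} {q' a : ℂ} {c : ℝ} (hq : HasDerivAt q q' a)
    (hc : ∀ᶠ s in 𝓝 a, c * ‖s - a‖ ≤ ‖q s - q a‖) : c ≤ ‖q'‖ := by
  refine ge_of_tendsto (hasDerivAt_iff_tendsto_slope.1 hq).norm ?_
  filter_upwards [nhdsWithin_le_nhds hc, self_mem_nhdsWithin] with s hs hsa
  rw [slope_def_field, norm_div]
  exact (le_div_iff₀ (norm_pos_iff.2 (sub_ne_zero.2 hsa))).2 hs

variable {E F : Type*} [NormedAddCommGroup E] [NormedSpace ℂ E] [NormedAddCommGroup F]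
  [NormedSpace ℂ F]

lemma hasDerivAt_comp_line {h : E → ℂ} {y u : E} {s : ℂ} (hh : DifferentiableAt ℂ h (y + s • u)) :
    HasDerivAt (fun s : ℂ => h (y + s • u)) (fderiv ℂ h (y + s • u) u) s := by
  have hline : HasDerivAt (fun s : ℂ => y + s • u) u s := by
    simpa using ((hasDerivAt_id s).smul_const u).const_add y
  exact hh.hasFDerivAt.comp_hasDerivAt s hline

lemma exists_nhds_eq_of_line_eq {H : E → F} {D : E →L[ℂ] F} {p u : E}
    (hH : HasStrictFDerivAt H D p) (hu : D u ≠ 0) :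
    ∃ W ∈ 𝓝 p, ∀ (y : E) (s s' : ℂ), y + s • u ∈ W → y + s' • u ∈ W →
      H (y + s • u) = H (y + s' • u) → s = s' := by
  have hu0 : 0 < ‖u‖ := norm_pos_iff.2 fun h => hu (by rw [h, map_zero])
  have hDu : 0 < ‖D u‖ := norm_pos_iff.2 hu
  have hlin := hH.isLittleO.def (show 0 < ‖D u‖ / (2 * ‖u‖) by positivity)
  rw [nhds_prod_eq] at hlin
  obtain ⟨W, hW, hWW⟩ := mem_prod_same_iff.1 hlin
  refine ⟨W, hW, fun y s s' hs hs' heq => ?_⟩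
  have hle : ‖s - s'‖ * ‖D u‖ ≤ ‖s - s'‖ * ‖D u‖ / 2 :=
    calc ‖s - s'‖ * ‖D u‖
        = ‖H (y + s • u) - H (y + s' • u) - D (y + s • u - (y + s' • u))‖ := by
          rw [heq, add_sub_add_left_eq_sub, ← sub_smul, map_smul, sub_self, zero_sub, norm_neg,
            norm_smul]
      _ ≤ ‖D u‖ / (2 * ‖u‖) * ‖y + s • u - (y + s' • u)‖ := hWW (Set.mk_mem_prod hs hs')
      _ = ‖s - s'‖ * ‖D u‖ / 2 := by
          rw [add_sub_add_left_eq_sub, ← sub_smul, norm_smul]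
          field_simp
  have hzero : ‖s - s'‖ * ‖D u‖ = 0 := by linarith [mul_nonneg (norm_nonneg (s - s')) hDu.le]
  exact sub_eq_zero.1 (norm_eq_zero.1 ((mul_eq_zero.1 hzero).resolve_right hDu.ne'))

lemma frequently_line_ne_zero {h : E → ℂ} {t u : E} {W : Set E} (hW : W ∈ 𝓝 t)
    (huniq : ∀ s : ℂ, t + s • u ∈ W → h (t + s • u) = 0 → s = 0) :
    ∃ᶠ s in 𝓝 (0 : ℂ), h (t + s • u) ≠ 0 := by
  have hline : ContinuousAt (fun s : ℂ => t + s • u) 0 := by fun_prop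
  have hne : ∃ᶠ s in 𝓝[≠] (0 : ℂ), s ≠ 0 :=
    Eventually.frequently (f := 𝓝[≠] (0 : ℂ)) eventually_mem_nhdsWithin
  refine ((hne.filter_mono nhdsWithin_le_nhds).and_eventually
    (hline.preimage_mem_nhds (by simpa using hW))).mono ?_
  exact fun s hs h0 => hs.1 (huniq s hs.2 h0)

/-- On nearby lines with simple zeros the minimum principle bounds `h` below by a multiple of the
distance to the zero that stays away from `0` as the line approaches `t`. -/
lemma fderiv_ne_zero_of_frequently_simple {h : E → ℂ} {t u : E} {W : Set E} (hh : AnalyticAt ℂ h t)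
    (ht : h t = 0) (hW : W ∈ 𝓝 t)
    (huniq : ∀ (y : E) (s s' : ℂ), y + s • u ∈ W → y + s' • u ∈ W →
      h (y + s • u) = 0 → h (y + s' • u) = 0 → s = s')
    (hsimple : ∃ᶠ y in 𝓝 t, ∀ s : ℂ, h (y + s • u) = 0 → fderiv ℂ h (y + s • u) u ≠ 0) :
    fderiv ℂ h t u ≠ 0 := by
  obtain ⟨r, hr, hr0, hrW⟩ := exists_disc_ne_zero_of_line hh
    (frequently_line_ne_zero hW fun s hs h0 =>
      huniq t s 0 hs (by simpa using mem_of_mem_nhds hW) h0 (by simpa using ht))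
    (inter_mem hW hh.eventually_analyticAt)
  have hrt : ∀ s : ℂ, ‖s‖ ≤ r → AnalyticAt ℂ h (t + s • u) := fun s hs =>
    (hrW.self_of_nhds s hs).2
  obtain ⟨m, hm, hsphere⟩ := exists_pos_forall_sphere_le_norm
    (fun s hs => (hrt s (mem_sphere_zero_iff_norm.1 hs).le).continuousAt)
    (fun s hs => hr0 s (mem_sphere_zero_iff_norm.1 hs).le (ne_of_mem_sphere hs hr.ne'))
  have hbound : ∃ᶠ y in 𝓝 t, ∀ s ∈ closedBall (0 : ℂ) r,
      m / (2 * r) * ‖s‖ ≤ ‖h (y + s • u)‖ + ‖h y‖ := by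
    refine (hsimple.and_eventually (hrW.and hsphere)).mono ?_
    rintro y ⟨hy, hyW, hym⟩ s hs
    simp only [← mem_closedBall_zero_iff (E := ℂ)] at hyW
    simpa using mul_norm_le_norm_add_norm (q := fun s => h (y + s • u)) hr hm
      (fun s hs => analyticAt_comp_line (hyW s hs).2)
      (fun s hs s' hs' => huniq y s s' (hyW s hs).1 (hyW s' hs').1)
      (fun s hs h0 => by
        rw [(hasDerivAt_comp_line (hyW s hs).2.differentiableAt).deriv]
        exact hy s h0) hym hs
  have hlim : ∀ s ∈ closedBall (0 : ℂ) r, m / (2 * r) * ‖s‖ ≤ ‖h (t + s • u)‖ := fun s hs => by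
    have hcont : ContinuousAt (fun y => h (y + s • u)) t :=
      (hrt s (mem_closedBall_zero_iff.1 hs)).continuousAt.comp (f := fun y => y + s • u)
        (by fun_prop)
    simpa [ht] using isClosed_Ici.mem_of_frequently_of_tendsto (hbound.mono fun y hy => hy s hs)
      (hcont.norm.add hh.continuousAt.norm)
  have hderiv : HasDerivAt (fun s : ℂ => h (t + s • u)) (fderiv ℂ h t u) 0 := by
    simpa using hasDerivAt_comp_line (s := 0) (u := u) (by simpa using hh.differentiableAt)
  refine norm_pos_iff.1 (lt_of_lt_of_le (by positivity : 0 < m / (2 * r))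
    (le_norm_of_hasDerivAt hderiv ?_))
  filter_upwards [closedBall_mem_nhds (0 : ℂ) hr] with s hs
  simpa [ht] using hlim s hs

end SimpleZeros

section SmoothZeroSet

open MvPolynomial

variable {ι : Type*} [Fintype ι]

lemma hasFDerivAt_eval {𝕜 : Type*} [NontriviallyNormedField 𝕜] (f : MvPolynomial ι 𝕜)
    (z : ι → 𝕜) : HasFDerivAt (fun z => eval z f)
      (∑ i, eval z (pderiv i f) • ContinuousLinearMap.proj (R := 𝕜) (φ := fun _ : ι => 𝕜) i) z := by
  classical
  induction f using MvPolynomial.induction_on with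
  | C c =>
    simp only [eval_C]
    refine (hasFDerivAt_const c z).congr_fderiv ?_
    ext w
    simp
  | add p q hp hq =>
    simp only [map_add]
    refine (hp.fun_add hq).congr_fderiv ?_
    ext w
    simp [add_mul, Finset.sum_add_distrib]
  | mul_X p j hp =>
    simp only [map_mul, eval_X]
    refine (hp.fun_mul (hasFDerivAt_apply (𝕜 := 𝕜) j z)).congr_fderiv ?_
    ext w
    simp [pderiv_X, Pi.single_apply, apply_ite, add_mul, Finset.sum_add_distrib, Finset.mul_sum,
      mul_assoc]

lemma fderiv_eval_apply {𝕜 : Type*} [NontriviallyNormedField 𝕜] (f : MvPolynomial ι 𝕜)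
    (z w : ι → 𝕜) : fderiv 𝕜 (fun z => eval z f) z w = ∑ i, w i * eval z (pderiv i f) := by
  simp [(hasFDerivAt_eval f z).fderiv, mul_comm]

lemma fderiv_eval_single {ι 𝕜 : Type*} [Finite ι] [DecidableEq ι] [NontriviallyNormedField 𝕜]
    (f : MvPolynomial ι 𝕜) (z : ι → 𝕜) (i : ι) :
    fderiv 𝕜 (fun z => eval z f) z (Pi.single i 1) = eval z (pderiv i f) := by
  have := Fintype.ofFinite ι
  simp [fderiv_eval_apply, Pi.single_apply]

lemma analyticAt_eval (f : MvPolynomial ι ℂ) (z : ι → ℂ) : AnalyticAt ℂ (fun z => eval z f) z :=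
  AnalyticOnNhd.eval_mvPolynomial f z trivial

lemma frequently_eval_ne_zero {ι : Type*} [Finite ι] {f : MvPolynomial ι ℂ} (hf : f ≠ 0)
    (t : ι → ℂ) : ∃ᶠ z in 𝓝 t, eval z f ≠ 0 := by
  have := Fintype.ofFinite ι
  refine fun h => hf (MvPolynomial.funext fun z => ?_)
  have han : AnalyticOnNhd ℂ (fun z => eval z f) Set.univ := fun z _ => analyticAt_eval f z
  simpa using congrFun (han.eq_of_eventuallyEq (g := 0) (fun z _ => analyticAt_const)
    (h.mono fun _ hz => not_not.1 hz)) z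

lemma isSmoothAt_of_fderiv_ne_zero {h : (ι → ℂ) → ℂ} {t w : ι → ℂ} (hh : AnalyticAt ℂ h t)
    (hw : fderiv ℂ h t w ≠ 0) : IsSmoothAt {z | h z = 0} t := by
  refine ⟨1, fun z _ => h z, analyticAt_pi_iff.2 fun _ => hh, fun y => ?_, ?_⟩
  · have hpi : HasFDerivAt (fun z (_ : Fin 1) => h z)
        (ContinuousLinearMap.pi fun _ => fderiv ℂ h t) t :=
      hasFDerivAt_pi.2 fun _ => hh.differentiableAt.hasFDerivAt
    refine ⟨(y 0 / fderiv ℂ h t w) • w, funext fun j => ?_⟩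
    rw [hpi.fderiv, Subsingleton.elim j 0]
    simp [hw]
  · simp [funext_iff]

lemma IsSmoothAt.exists_single [DecidableEq ι] {S : Set (ι → ℂ)} {t : ι → ℂ} (hS : IsSmoothAt S t)
    (hne : ¬ ∀ᶠ z in 𝓝 t, z ∈ S) : ∃ i : ι, ∃ W ∈ 𝓝 t, ∀ (y : ι → ℂ) (s s' : ℂ),
      y + s • Pi.single i 1 ∈ W → y + s' • Pi.single i 1 ∈ W →
      y + s • Pi.single i 1 ∈ S → y + s' • Pi.single i 1 ∈ S → s = s' := by
  obtain ⟨r, H, hH, hsurj, hSH⟩ := hS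
  have hr : Nonempty (Fin r) := by
    by_contra hr
    rw [not_nonempty_iff] at hr
    exact hne (hSH.mono fun z hz => hz.2 (Subsingleton.elim _ _))
  obtain ⟨i, hi⟩ : ∃ i, fderiv ℂ H t (Pi.single i 1) ≠ 0 := by
    by_contra! hzero
    obtain ⟨w, hw⟩ := hsurj (fun _ => 1)
    have hD : fderiv ℂ H t = 0 := ContinuousLinearMap.coe_injective <|
      LinearMap.pi_ext' fun i => LinearMap.ext_ring (hzero i)
    rw [hD, zero_apply] at hw
    exact zero_ne_one (congrFun hw hr.some)
  obtain ⟨W, hW, hline⟩ := exists_nhds_eq_of_line_eq hH.hasStrictFDerivAt hi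
  refine ⟨i, W ∩ {z | z ∈ S ↔ H z = 0}, Filter.inter_mem hW hSH,
    fun y s s' hs hs' hsS hsS' => hline y s s' hs.1 hs'.1 ?_⟩
  rw [hs.2.1 hsS, hs'.2.1 hsS']

lemma exists_pderiv_ne_zero_of_isSmoothAt {f : MvPolynomial ι ℂ} (hf : Squarefree f)
    {t : ι → ℂ} (ht : eval t f = 0) (hs : IsSmoothAt {z | eval z f = 0} t) :
    ∃ i, eval t (pderiv i f) ≠ 0 := by
  classical
  obtain ⟨i, W, hW, huniq⟩ := hs.exists_single fun h =>
    frequently_eval_ne_zero hf.ne_zero t (h.mono fun z hz => not_not.2 hz)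
  obtain ⟨A, B, D, hD, hABD⟩ := exists_bezout_pderiv hf i
  have hD0 : rename Subtype.val D ≠ 0 :=
    (map_ne_zero_iff _ (rename_injective _ Subtype.val_injective)).2 hD
  refine ⟨i, ?_⟩
  rw [← fderiv_eval_single]
  refine fderiv_ne_zero_of_frequently_simple (analyticAt_eval f t) ht hW huniq
    ((frequently_eval_ne_zero hD0 t).mono fun y hy s h0 hd => hy ?_)
  rw [fderiv_eval_single] at hd
  have hconst : eval y (rename Subtype.val D) =
      eval (y + s • Pi.single i 1) (rename Subtype.val D) := by
    rw [eval_rename, eval_rename]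
    congr 2
    ext j
    simp [j.2]
  rw [hconst, ← hABD]
  simp [h0, hd]

end SmoothZeroSet

section Toric

variable {N : Type*} [AddCommGroup N] {F : Fan N} {d : ℕ} {f : MvPolynomial (Ray F) ℂ}
  {β : ClassGp F}

open MvPolynomial

lemma FullCone.exists_pderiv_ne_zero (σ : FullCone F d) (hf : IsDHomogeneous F f β)
    {v : Fin d → ℂ} (hv : eval (σ.slice v) f = 0) {i : Ray F}
    (hi : eval (σ.slice v) (pderiv i f) ≠ 0) :
    ∃ j, j.gen ∈ σ.cone ∧ eval (σ.slice v) (pderiv j f) ≠ 0 := by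
  classical
  by_contra! hzero
  obtain ⟨y, hy⟩ := σ.exists_fderiv_sliceDir_eq (analyticAt_eval f _).differentiableAt
    (.of_forall (by
      rintro z ⟨c, hc, rfl⟩
      exact (hf.eval_smul_eq_zero_iff hc _).2 hv)) (Pi.single i 1)
  rw [fderiv_eval_single, fderiv_eval_apply] at hy
  refine hi (hy.symm.trans (Finset.sum_eq_zero fun j _ => ?_))
  by_cases hj : j.gen ∈ σ.cone
  · rw [hzero j hj, mul_zero]
  · rw [σ.sliceDir_of_notMem _ ((σ.gen_mem_cone_iff j).not.1 hj), zero_mul]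

theorem isSmoothAt_zeroSet_iff [Module.Free ℤ N] [Module.Finite ℤ N]
    (hd : Module.finrank ℤ N = d) (hf : IsDHomogeneous F f β) (hsq : Squarefree f)
    {s : Finset N} (hs : s ∈ F.cones) (hcard : s.card = d) {t : Ray F → ℂ} (ht : t ∈ zeroSet F f)
    (h1 : ∀ i, i.gen ∉ s → t i = 1) :
    IsSmoothAt (zeroSet F f) t ↔ ∃ i, i.gen ∈ s ∧ eval t (pderiv i f) ≠ 0 := by
  classical
  refine ⟨fun hsmooth => ?_, fun ⟨i, _, hi⟩ =>
    isSmoothAt_of_fderiv_ne_zero (analyticAt_eval f t) (by rwa [fderiv_eval_single f t i])⟩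
  obtain ⟨σ, rfl⟩ := F.exists_fullCone_eq hd hs hcard
  obtain ⟨i, hi⟩ := exists_pderiv_ne_zero_of_isSmoothAt hsq ht hsmooth
  have htσ : t = σ.slice (t ∘ σ.idx) :=
    σ.eq_slice fun i hiσ => h1 i ((σ.gen_mem_cone_iff i).not.2 hiσ)
  rw [htσ] at ht hi ⊢
  exact σ.exists_pderiv_ne_zero hf ht hi

end Toric

end ToricHyp

end

theorem mainTheorem7 {N : Type*} [AddCommGroup N] [Module.Free ℤ N] [Module.Finite ℤ N]
    (d : ℕ) (hd : Module.finrank ℤ N = d) (F : ToricHyp.Fan N)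
    (f : MvPolynomial (ToricHyp.Ray F) ℂ) (β : ToricHyp.ClassGp F)
    (hf : ToricHyp.IsDHomogeneous F f β) :
    (ToricHyp.IsQuasiSmooth F f ↔
      ToricHyp.IsVSubmanifold F d (ToricHyp.hypersurface F f)) ∧
    (Squarefree f →
      ∀ σ ∈ F.cones, σ.card = d → ∀ t ∈ ToricHyp.zeroSet F f, (∀ i, i.gen ∉ σ → t i = 1) →
        (ToricHyp.IsSmoothAt (ToricHyp.zeroSet F f) t ↔
          ∃ i, i.gen ∈ σ ∧ MvPolynomial.eval t (MvPolynomial.pderiv i f) ≠ 0)) := by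
  exact ⟨⟨fun h => h.isVSubmanifold hd hf, fun h => h.isQuasiSmooth hd hf⟩,
    fun hsq _ hs hcard _ ht h1 => ToricHyp.isSmoothAt_zeroSet_iff hd hf hsq hs hcard ht h1⟩
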